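/- Let $\mathbb F_q$ be a finite field with $q$ elements, $A=\mathbb F_q[\theta]$, $A_+\subset A$ the set of monic polynomials, $K=\mathbb F_q(\theta)$, and $K_\infty$ the completion of $K$ at the place $\infty$. Put $\ell_d=\prod_{i=1}^d(\theta-\theta^{q^i})$ for $d\ge 0$ (so $\ell_0=1$). A positive array of depth $r\ge 0$ and weight $w$ consists of $\mathfrak s=(s_1,\dots,s_r)$ with integers $s_i\ge 1$, $s_1+\dots+s_r=w$, and $\boldsymbol\varepsilon=(\varepsilon_1,\dots,\varepsilon_r)\in(\mathbb F_q^\times)^r$. Its alternating multiple zeta value (AMZV) and its alternating Carlitz multiple polylogarithm (ACMPL) are the elements of $K_\infty$ $$\zeta_A\begin{pmatrix}\boldsymbol\varepsilon\\ \mathfrak s\end{pmatrix}=\sum_{\substack{a_1,\dots,a_r\in A_+\\ \deg a_1>\dots>\deg a_r\ge 0}}\frac{\varepsilon_1^{\deg a_1}\cdots\varepsilon_r^{\deg a_r}}{a_1^{s_1}\cdots a_r^{s_r}},\qquad \operatorname{Li}\begin{pmatrix}\boldsymbol\varepsilon\\ \mathfrak s\end{pmatrix}=\sum_{d_1>\dots>d_r\ge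 0}\frac{\varepsilon_1^{d_1}\cdots\varepsilon_r^{d_r}}{\ell_{d_1}^{s_1}\cdots\ell_{d_r}^{s_r}}$$ (both equal to $1$ for the empty array). For an integer $w\ge 0$ let $\mathcal{AZ}_w$ (resp. $\mathcal{AL}_w$) be the $K$-linear span in $K_\infty$ of all AMZV's (resp. all ACMPL's) of weight $w$, and let $\mathcal{AT}_w$ be the set of ACMPL's of weight $w$ given by arrays with $s_1,\dots,s_{r-1}\le q$ and $s_r<q$. **Theorem.** For every $w\ge 0$, all the series above of weight $w$ converge unconditionally in $K_\infty$, and $$\mathcal{AZ}_w=\mathcal{AL}_w .$$ Moreover, $\zeta_A\begin{pmatrix}\boldsymbol\varepsilon\\ \mathfrak s\end{pmatrix}=\operatorname{Li}\begin{pmatrix}\boldsymbol\varepsilon\\ \mathfrak s\end{pmatrix}$ for every array of weight $w$ with $s_1,\dots,s_{r-1}\le q$ and $s_r<q$, so that $\mathcal{AT}_w$ is also a set of AMZV's, and $\mathcal{AT}_w$ generates both $\mathcal{AL}_w$ and $\mathcal{AZ}_w$ over $K$. -/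

import Mathlib

/-! Throughout `F` is the finite field `𝔽_q`, so `q = Fintype.card F`, `A = F[θ]` is `Polynomial F`,
`K = F(θ)` is `RatFunc F` with `θ = RatFunc.X`, and `K_∞`, the completion of `K` at the place `∞`
(where `|θ| > 1`), is `RatFunc.CompletionAtInfty F`. -/

noncomputable section

namespace CharPMZV

/-- A positive array: a tuple `s = (s_1, …, s_r)` of positive integers together with a tuple
`ε = (ε_1, …, ε_r)` of elements of `𝔽_q^×` (the index `i : Fin r` stands for `i + 1`). -/
structure PositiveArray (F : Type*) [Field F] where
  depth : ℕ
  ε : Fin depth → Fˣ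
  s : Fin depth → ℕ
  s_pos : ∀ i, 0 < s i

/-- The weight `s_1 + ⋯ + s_r`. -/
def PositiveArray.weight {F : Type*} [Field F] (a : PositiveArray F) : ℕ :=
  ∑ i, a.s i

/-- The arrays with `s_1, …, s_{r-1} ≤ q` and `s_r < q`. -/
def PositiveArray.IsAT {F : Type*} [Field F] [Fintype F] (a : PositiveArray F) : Prop :=
  ∀ i : Fin a.depth, a.s i ≤ Fintype.card F ∧ (i.val + 1 = a.depth → a.s i < Fintype.card F)

/-- `ℓ_d = ∏_{i=1}^d (θ - θ^{q^i})`, with `ℓ_0 = 1`. -/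
def ell (F : Type*) [Field F] [Fintype F] (d : ℕ) : RatFunc F :=
  ∏ i ∈ Finset.Icc 1 d, (RatFunc.X - RatFunc.X ^ (Fintype.card F ^ i))

/-- Tuples `(a_1, …, a_r)` of monic polynomials with `deg a_1 > ⋯ > deg a_r`. -/
abbrev MonicTuple (F : Type*) [Field F] (r : ℕ) : Type _ :=
  {P : Fin r → Polynomial F // (∀ i, (P i).Monic) ∧ StrictAnti fun i => (P i).natDegree}

/-- Tuples of integers `d_1 > ⋯ > d_r ≥ 0`. -/
abbrev DegreeTuple (r : ℕ) : Type :=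
  {d : Fin r → ℕ // StrictAnti d}

/-- `ε_1^{deg a_1} ⋯ ε_r^{deg a_r} / (a_1^{s_1} ⋯ a_r^{s_r})`, as an element of `K_∞`. -/
def zetaTerm {F : Type*} [Field F] [DecidableEq (RatFunc F)]
    (a : PositiveArray F) (P : MonicTuple F a.depth) : RatFunc.CompletionAtInfty F :=
  algebraMap (RatFunc F) (RatFunc.CompletionAtInfty F)
    (∏ i, RatFunc.C (a.ε i : F) ^ (P.1 i).natDegree /
      (algebraMap (Polynomial F) (RatFunc F) (P.1 i)) ^ a.s i)

/-- `ε_1^{d_1} ⋯ ε_r^{d_r} / (ℓ_{d_1}^{s_1} ⋯ ℓ_{d_r}^{s_r})`, as an element of `K_∞`. -/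
def liTerm {F : Type*} [Field F] [Fintype F] [DecidableEq (RatFunc F)]
    (a : PositiveArray F) (d : DegreeTuple a.depth) : RatFunc.CompletionAtInfty F :=
  algebraMap (RatFunc F) (RatFunc.CompletionAtInfty F)
    (∏ i, RatFunc.C (a.ε i : F) ^ d.1 i / ell F (d.1 i) ^ a.s i)

/-- The alternating multiple zeta value `ζ_A(ε; s)`. -/
def zeta {F : Type*} [Field F] [DecidableEq (RatFunc F)]
    (a : PositiveArray F) : RatFunc.CompletionAtInfty F :=
  ∑' P : MonicTuple F a.depth, zetaTerm a P

/-- The alternating Carlitz multiple polylogarithm `Li(ε; s)`. -/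
def Li {F : Type*} [Field F] [Fintype F] [DecidableEq (RatFunc F)]
    (a : PositiveArray F) : RatFunc.CompletionAtInfty F :=
  ∑' d : DegreeTuple a.depth, liTerm a d

/-- The `K`-span `𝒜𝒵_w` of the AMZV's of weight `w`. -/
def AZ (F : Type*) [Field F] [DecidableEq (RatFunc F)] (w : ℕ) :
    Submodule (RatFunc F) (RatFunc.CompletionAtInfty F) :=
  Submodule.span (RatFunc F) {x | ∃ a : PositiveArray F, a.weight = w ∧ zeta a = x}

/-- The `K`-span `𝒜ℒ_w` of the ACMPL's of weight `w`. -/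
def AL (F : Type*) [Field F] [Fintype F] [DecidableEq (RatFunc F)] (w : ℕ) :
    Submodule (RatFunc F) (RatFunc.CompletionAtInfty F) :=
  Submodule.span (RatFunc F) {x | ∃ a : PositiveArray F, a.weight = w ∧ Li a = x}

/-- The set `𝒜𝒯_w` of all ACMPL's of weight `w` with `s_1, …, s_{r-1} ≤ q` and `s_r < q`. -/
def AT (F : Type*) [Field F] [Fintype F] [DecidableEq (RatFunc F)] (w : ℕ) :
    Set (RatFunc.CompletionAtInfty F) :=
  {x | ∃ a : PositiveArray F, a.weight = w ∧ a.IsAT ∧ Li a = x}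

end CharPMZV

end

/-! Write `K = F(θ)` and consider, for a word `W = a_1 ⋯ a_r` in letters `a_i = (ε_i, s_i)`, the
nested sum `d ↦ ∑_{d > d_1 > ⋯ > d_r ≥ 0} ∏ ε_i^{d_i} / ℓ_{d_i}^{s_i}`, a function `ℕ → K`. Its
limit in `K_∞` for `d → ∞` is the polylogarithm of the array, and linear relations between such
functions, up to functions tending to zero, give linear relations between the limits. By the
quasi-shuffle product, the product of nested sums of weights `m` and `n` is a combination of nested
sums of weight `m + n` (`mul_mem_liSpan`).

The basic identity is `ℓ_d^{-q} = ℓ_1 ℓ_{d+1}^{-1} ∑_{j ≤ d} ℓ_j^{-(q-1)}` (`inv_ell_pow_card`),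
which follows by telescoping. It is used in two ways.

*The words with `s_1, …, s_{r-1} ≤ q` and `s_r < q` suffice for polylogarithms.* Multiplying the
identity by a nested sum and summing over `d` rewrites a letter `s > q`, or a last letter `s = q`,
with `V` the rest of the word: `U u s V` becomes a combination of `U u q (s-q) V`, `U u 1 X` and
`U (u+1) X`, where `X` runs through the quasi-shuffle product of the letter `q - 1` with `(s-q) V`;
for a last letter `s = q` the first term is absent and `X` is the letter `q - 1`. If the bad letter
comes first, the last kind of term is replaced by a function tending to zero.
These words are either longer than the original one, or of the same length and lexicographically
larger, because `u` has become `u + 1`. In a fixed weight this can happen only finitely often, so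
the rewriting terminates (`nestedSum_mem_goodSpan_sup`).

*Zeta values are combinations of polylogarithms.* The Frobenius twists of the identity show by
induction on `i` that `d ↦ ℓ_{d-i}^{-q^i}` is a combination of polylogarithmic sums of weight `q^i`
(`ellTwist_mem_liTopSpan`). By Carlitz, `∏ (1 - x / a) = 1 - E_d(x)`, the product being over the
monic `a` of degree `d`, where `E_d(x) = ∑_i x^{q^i} / (D_i ℓ_{d-i}^{q^i})` and
`D_i` is the product of the monic polynomials of degree `i`. The derivative of `E_d` is the constant
`1 / ℓ_d`, so the logarithmic derivative of the product gives a recursion for the power sums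
`S_d(k)` of the `1 / a^k` (`powerSum_succ`). Hence `S_d(k) = ℓ_d^{-k}` for `k ≤ q`, and
in general `d ↦ S_d(k)` is a combination of polylogarithmic sums of weight `k`
(`powerSum_mem_liTopSpan`). The first fact identifies zeta values and polylogarithms of arrays with
all `s_i ≤ q`, the second shows that every zeta value is a combination of polylogarithms of the same
weight. -/

noncomputable section

namespace CharPMZV

open Finset

/-! ### The products `ℓ_d` and their Frobenius twists -/

section Ell

variable (F : Type*) [Field F] [Fintype F]

local notation "q" => Fintype.card F
local notation "θ" => (RatFunc.X : RatFunc F)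

theorem sub_pow_card (x y : RatFunc F) : (x - y) ^ q = x ^ q - y ^ q :=
  map_sub (FiniteField.frobeniusAlgHom F (RatFunc F)) x y

theorem sum_pow_card {ι : Type*} (s : Finset ι) (f : ι → RatFunc F) :
    (∑ i ∈ s, f i) ^ q = ∑ i ∈ s, f i ^ q :=
  map_sum (FiniteField.frobeniusAlgHom F (RatFunc F)) f s

theorem X_sub_X_pow_ne_zero {n : ℕ} (hn : n ≠ 0) : θ - θ ^ q ^ n ≠ 0 := by
  intro h
  have h1 : (Polynomial.X : Polynomial F) = Polynomial.X ^ q ^ n := by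
    apply RatFunc.algebraMap_injective F
    simpa [RatFunc.algebraMap_X] using sub_eq_zero.mp h
  have h2 := congrArg Polynomial.natDegree h1
  rw [Polynomial.natDegree_X, Polynomial.natDegree_X_pow] at h2
  exact (Nat.one_lt_pow hn Fintype.one_lt_card).ne h2

theorem ell_zero : ell F 0 = 1 := by simp [ell]

theorem ell_succ (d : ℕ) : ell F (d + 1) = ell F d * (θ - θ ^ q ^ (d + 1)) := by
  simp [ell, Finset.prod_Icc_succ_top]

theorem ell_ne_zero (d : ℕ) : ell F d ≠ 0 :=
  Finset.prod_ne_zero_iff.mpr fun i hi => X_sub_X_pow_ne_zero F (by simp at hi; omega)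

/-- A telescoping identity: since `ℓ_{d+1}^q = ℓ_d^q (θ^q - θ^{q^{d+2}})`, both sides have the same
increments. -/
theorem sum_inv_ell_pow_mul (d : ℕ) :
    (∑ j ∈ range (d + 1), (ell F j)⁻¹ ^ (q - 1)) * ell F 1 * ell F d ^ q = ell F (d + 1) := by
  have hq : 0 < q := Fintype.card_pos
  induction d with
  | zero => simp [ell_zero]
  | succ d ih =>
    have h1 : (ell F (d + 1))⁻¹ ^ (q - 1) * ell F (d + 1) ^ q = ell F (d + 1) := by
      obtain ⟨m, hm⟩ : ∃ m, q = m + 1 := ⟨q - 1, by omega⟩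
      rw [hm, Nat.add_sub_cancel, pow_succ, ← mul_assoc, ← mul_pow,
        inv_mul_cancel₀ (ell_ne_zero F _), one_pow, one_mul]
    have h2 : ell F (d + 1) ^ q = ell F d ^ q * (θ ^ q - θ ^ q ^ (d + 2)) := by
      rw [ell_succ, mul_pow, sub_pow_card, ← pow_mul, ← pow_succ]
    have h3 : ell F 1 = θ - θ ^ q := by simp [ell]
    calc _ = (∑ j ∈ range (d + 1), (ell F j)⁻¹ ^ (q - 1)) * ell F 1 * ell F (d + 1) ^ q
          + ell F 1 * ((ell F (d + 1))⁻¹ ^ (q - 1) * ell F (d + 1) ^ q) := by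
          rw [sum_range_succ _ (d + 1)]; ring
      _ = (∑ j ∈ range (d + 1), (ell F j)⁻¹ ^ (q - 1)) * ell F 1 * ell F d ^ q
            * (θ ^ q - θ ^ q ^ (d + 2)) + ell F 1 * ell F (d + 1) := by
          rw [h1, h2]; ring
      _ = ell F (d + 1 + 1) := by rw [ih, h3, ell_succ F (d + 1)]; ring

/-- The fundamental relation `ℓ_d^{-q} = ℓ_1 ℓ_{d+1}^{-1} ∑_{j ≤ d} ℓ_j^{-(q-1)}`. -/
theorem inv_ell_pow_card (d : ℕ) :
    (ell F d)⁻¹ ^ q =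
      ell F 1 * (ell F (d + 1))⁻¹ * ∑ j ∈ range (d + 1), (ell F j)⁻¹ ^ (q - 1) := by
  have h1 := ell_ne_zero F (d + 1)
  have h0 : ell F d ^ q ≠ 0 := pow_ne_zero _ (ell_ne_zero F d)
  apply mul_right_cancel₀ h0
  rw [inv_pow, inv_mul_cancel₀ h0]
  calc (1 : RatFunc F) = (ell F (d + 1))⁻¹ * ell F (d + 1) := (inv_mul_cancel₀ h1).symm
    _ = (ell F (d + 1))⁻¹ *
        ((∑ j ∈ range (d + 1), (ell F j)⁻¹ ^ (q - 1)) * ell F 1 * ell F d ^ q) := by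
        rw [sum_inv_ell_pow_mul]
    _ = _ := by ring

/-- The functions `d ↦ ℓ_{d-i}^{-q^i}`, extended by zero to `d < i`. -/
def ellTwist : ℕ → ℕ → RatFunc F
  | 0, d => (ell F d)⁻¹
  | _ + 1, 0 => 0
  | i + 1, d + 1 => ellTwist i d ^ q

theorem ellTwist_of_lt {i d : ℕ} (h : d < i) : ellTwist F i d = 0 := by
  induction i generalizing d with
  | zero => omega
  | succ i ih =>
    cases d with
    | zero => rfl
    | succ d =>
      rw [ellTwist, ih (by omega), zero_pow Fintype.card_ne_zero]

/-- The Frobenius twists of the fundamental relation. -/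
theorem ellTwist_succ (i d : ℕ) :
    ellTwist F (i + 1) d =
      ell F 1 ^ q ^ i * (ellTwist F i d * ∑ j ∈ range d, ellTwist F i j ^ (q - 1)) := by
  have hq : 1 < q := Fintype.one_lt_card
  induction i generalizing d with
  | zero =>
    cases d with
    | zero => simp [ellTwist]
    | succ d =>
      simp only [ellTwist]
      rw [inv_ell_pow_card, pow_zero, pow_one, mul_assoc]
  | succ i ih =>
    cases d with
    | zero => simp [ellTwist]
    | succ d =>
      rw [sum_range_succ']
      conv_lhs => rw [ellTwist, ih]
      simp only [ellTwist, zero_pow (Nat.sub_ne_zero_of_lt hq), add_zero, mul_pow, sum_pow_card]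
      rw [← pow_mul, ← pow_succ]
      simp only [← pow_mul, mul_comm]

theorem ellTwist_eq_succ_mul (i d : ℕ) :
    ellTwist F i d = ellTwist F i (d + 1) * (θ ^ q ^ i - θ ^ q ^ (d + 1)) := by
  induction i generalizing d with
  | zero =>
    simp only [ellTwist, pow_zero, pow_one]
    rw [ell_succ, mul_inv, mul_assoc, inv_mul_cancel₀ (X_sub_X_pow_ne_zero F (by omega)), mul_one]
  | succ i ih =>
    cases d with
    | zero =>
      cases i with
      | zero => simp [ellTwist]
      | succ i => simp [ellTwist, zero_pow Fintype.card_ne_zero]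
    | succ d =>
      rw [ellTwist, ellTwist, ih d, mul_pow, sub_pow_card, ← pow_mul, ← pow_mul, ← pow_succ,
        ← pow_succ]

end Ell

/-! ### Nested sums and their products -/

section NestedSum

variable {K L : Type*} [Field K]

/-- The linear map `f ↦ (d ↦ ∑_{j < d} g(j) f(j))` on functions `ℕ → K`. -/
def weightedSum (g : ℕ → K) : (ℕ → K) →ₗ[K] (ℕ → K) where
  toFun f d := ∑ j ∈ range d, g j * f j
  map_add' f h := by ext d; simp [mul_add, sum_add_distrib]
  map_smul' c f := by ext d; simp [mul_sum, mul_left_comm]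

theorem weightedSum_apply (g f : ℕ → K) (d : ℕ) :
    weightedSum g f d = ∑ j ∈ range d, g j * f j := rfl

/-- The nested sum `∑_{d > d_1 > ⋯ > d_r ≥ 0} φ_{a_1}(d_1) ⋯ φ_{a_r}(d_r)` of a word `a_1 ⋯ a_r`, as
a function of `d`; it is the constant `1` for the empty word. -/
def nestedSum (φ : L → ℕ → K) (W : List L) : ℕ → K :=
  W.foldr (fun a f => weightedSum (φ a) f) 1

@[simp] theorem nestedSum_nil (φ : L → ℕ → K) : nestedSum φ [] = 1 := rfl

theorem nestedSum_cons (φ : L → ℕ → K) (a : L) (W : List L) :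
    nestedSum φ (a :: W) = weightedSum (φ a) (nestedSum φ W) := rfl

/-- Prefixing a word is a linear operation on nested sums. -/
def prefixMap (φ : L → ℕ → K) (U : List L) : (ℕ → K) →ₗ[K] (ℕ → K) :=
  U.foldr (fun a T => weightedSum (φ a) ∘ₗ T) LinearMap.id

theorem prefixMap_nestedSum (φ : L → ℕ → K) (U W : List L) :
    prefixMap φ U (nestedSum φ W) = nestedSum φ (U ++ W) := by
  induction U with
  | nil => rfl
  | cons a U ih =>
    rw [List.cons_append, nestedSum_cons, ← ih]; rfl

theorem prefixMap_append_singleton (φ : L → ℕ → K) (U : List L) (a : L) (f : ℕ → K) :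
    prefixMap φ (U ++ [a]) f = prefixMap φ U (weightedSum (φ a) f) := by
  induction U with
  | nil => rfl
  | cons b U ih =>
    change weightedSum (φ b) (prefixMap φ (U ++ [a]) f) = _
    rw [ih]; rfl

/-- The quasi-shuffle product of two weighted sums: the index pairs `(i, j)` are split according to
`i > j`, `i < j` and `i = j`. -/
theorem weightedSum_mul_weightedSum (g h f k : ℕ → K) :
    weightedSum g f * weightedSum h k =
      weightedSum g (f * weightedSum h k) + weightedSum h (weightedSum g f * k)
        + weightedSum (g * h) (f * k) := by
  ext d
  simp only [Pi.mul_apply, Pi.add_apply, weightedSum_apply]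
  induction d with
  | zero => simp
  | succ d ih =>
    simp only [sum_range_succ _ d]
    linear_combination ih

end NestedSum

/-! ### Words and the spans of their nested sums -/

section Words

variable {F : Type*} [Field F]

/-- A word of weight `w` in the letters `(ε, s)`, where `s` must be positive. -/
structure IsWord (w : ℕ) (W : List (Fˣ × ℕ)) : Prop where
  pos : ∀ a ∈ W, 0 < a.2
  weight_eq : (W.map Prod.snd).sum = w

theorem IsWord.nil : IsWord (F := F) 0 [] := ⟨by simp, rfl⟩

theorem isWord_cons {w : ℕ} {a : Fˣ × ℕ} {W : List (Fˣ × ℕ)} :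
    IsWord w (a :: W) ↔ 0 < a.2 ∧ ∃ m, IsWord m W ∧ a.2 + m = w := by
  constructor
  · rintro ⟨h1, h2⟩
    simp only [List.mem_cons, forall_eq_or_imp] at h1
    exact ⟨h1.1, _, ⟨h1.2, rfl⟩, by simpa using h2⟩
  · rintro ⟨h1, m, ⟨h2, h3⟩, h4⟩
    exact ⟨by simpa using ⟨h1, by simpa using h2⟩, by simp [h3, h4]⟩

theorem isWord_append {w : ℕ} {U W : List (Fˣ × ℕ)} :
    IsWord w (U ++ W) ↔ ∃ m n, IsWord m U ∧ IsWord n W ∧ m + n = w := by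
  constructor
  · rintro ⟨h1, h2⟩
    exact ⟨_, _, ⟨fun a ha => h1 a (by simp [ha]), rfl⟩, ⟨fun a ha => h1 a (by simp [ha]), rfl⟩,
      by simpa using h2⟩
  · rintro ⟨m, n, ⟨h1, h2⟩, ⟨h3, h4⟩, h5⟩
    exact ⟨fun a ha => (List.mem_append.mp ha).elim (h1 a) (h3 a), by simp [h2, h4, h5]⟩

variable [Fintype F]

local notation "q" => Fintype.card F

/-- The function `d ↦ ε^d / ℓ_d^s` attached to the letter `(ε, s)`. -/
def liLetter (a : Fˣ × ℕ) (d : ℕ) : RatFunc F :=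
  RatFunc.C (a.1 : F) ^ d * (ell F d)⁻¹ ^ a.2

theorem liLetter_mul (a b : Fˣ × ℕ) :
    liLetter a * liLetter b = liLetter (a.1 * b.1, a.2 + b.2) := by
  ext d
  simp only [liLetter, Pi.mul_apply, Units.val_mul, map_mul, mul_pow, pow_add]
  ring

variable (F) in
/-- The span of the functions `d ↦ ∑_{d > d_1 > ⋯ > d_r} ∏ ε_i^{d_i} / ℓ_{d_i}^{s_i}` of weight
`w`. -/
def liSpan (w : ℕ) : Submodule (RatFunc F) (ℕ → RatFunc F) :=
  Submodule.span _ {f | ∃ W : List (Fˣ × ℕ), IsWord w W ∧ nestedSum liLetter W = f}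

variable (F) in
/-- The span of the functions `d ↦ ∑_{d = d_1 > d_2 > ⋯ > d_r} ∏ ε_i^{d_i} / ℓ_{d_i}^{s_i}` of
weight `w` and depth `r ≥ 1`. -/
def liTopSpan (w : ℕ) : Submodule (RatFunc F) (ℕ → RatFunc F) :=
  Submodule.span _ {f | ∃ (a : Fˣ × ℕ) (W : List (Fˣ × ℕ)), IsWord w (a :: W) ∧
    liLetter a * nestedSum liLetter W = f}

theorem nestedSum_mem_liSpan {w : ℕ} {W : List (Fˣ × ℕ)} (h : IsWord w W) :
    nestedSum liLetter W ∈ liSpan F w := Submodule.subset_span ⟨W, h, rfl⟩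

theorem weightedSum_mem_liSpan {w : ℕ} {a : Fˣ × ℕ} (ha : 0 < a.2) {f : ℕ → RatFunc F}
    (hf : f ∈ liSpan F w) : weightedSum (liLetter a) f ∈ liSpan F (a.2 + w) := by
  induction hf using Submodule.span_induction with
  | mem f hf =>
    obtain ⟨W, hW, rfl⟩ := hf
    exact nestedSum_mem_liSpan (W := a :: W) (isWord_cons.mpr ⟨ha, w, hW, rfl⟩)
  | zero => rw [map_zero]; exact zero_mem _
  | add f g _ _ hf hg => rw [map_add]; exact add_mem hf hg
  | smul c f _ hf => rw [map_smul]; exact Submodule.smul_mem _ c hf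

theorem nestedSum_mul_mem_liSpan {m n : ℕ} {U V : List (Fˣ × ℕ)} (hU : IsWord m U)
    (hV : IsWord n V) : nestedSum liLetter U * nestedSum liLetter V ∈ liSpan F (m + n) := by
  induction U generalizing m n V with
  | nil =>
    obtain rfl : 0 = m := hU.weight_eq
    simpa using nestedSum_mem_liSpan hV
  | cons a U ihU =>
    induction V generalizing n with
    | nil =>
      obtain rfl : 0 = n := hV.weight_eq
      simpa using nestedSum_mem_liSpan hU
    | cons b V ihV =>
      obtain ⟨ha, m', hU', rfl⟩ := isWord_cons.mp hU
      obtain ⟨hb, n', hV', rfl⟩ := isWord_cons.mp hV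
      rw [nestedSum_cons, nestedSum_cons, weightedSum_mul_weightedSum, liLetter_mul,
        ← nestedSum_cons, ← nestedSum_cons]
      refine add_mem (add_mem ?_ ?_) ?_
      · convert weightedSum_mem_liSpan ha (ihU hU' hV) using 1
        ring_nf
      · convert weightedSum_mem_liSpan hb (ihV hV') using 1
        ring_nf
      · convert weightedSum_mem_liSpan (a := (a.1 * b.1, a.2 + b.2)) (by simp [ha])
          (ihU hU' hV') using 1
        ring_nf

theorem mul_mem_liSpan {m n : ℕ} {f g : ℕ → RatFunc F} (hf : f ∈ liSpan F m)
    (hg : g ∈ liSpan F n) : f * g ∈ liSpan F (m + n) := by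
  induction hf, hg using Submodule.span_induction₂ with
  | mem_mem f g hf hg =>
    obtain ⟨U, hU, rfl⟩ := hf
    obtain ⟨V, hV, rfl⟩ := hg
    exact nestedSum_mul_mem_liSpan hU hV
  | zero_left => rw [zero_mul]; exact zero_mem _
  | zero_right => rw [mul_zero]; exact zero_mem _
  | add_left f g h _ _ _ h1 h2 => rw [add_mul]; exact add_mem h1 h2
  | add_right f g h _ _ _ h1 h2 => rw [mul_add]; exact add_mem h1 h2
  | smul_left c f g _ _ h => rw [smul_mul_assoc]; exact Submodule.smul_mem _ c h
  | smul_right c f g _ _ h => rw [mul_smul_comm]; exact Submodule.smul_mem _ c h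

theorem liLetter_mul_mem_liTopSpan {w : ℕ} {a : Fˣ × ℕ} (ha : 0 < a.2) {f : ℕ → RatFunc F}
    (hf : f ∈ liSpan F w) : liLetter a * f ∈ liTopSpan F (a.2 + w) := by
  induction hf using Submodule.span_induction with
  | mem f hf =>
    obtain ⟨W, hW, rfl⟩ := hf
    exact Submodule.subset_span ⟨a, W, isWord_cons.mpr ⟨ha, w, hW, rfl⟩, rfl⟩
  | zero => rw [mul_zero]; exact zero_mem _
  | add f g _ _ hf hg => rw [mul_add]; exact add_mem hf hg
  | smul c f _ hf => rw [mul_smul_comm]; exact Submodule.smul_mem _ c hf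

theorem liLetter_mem_liTopSpan {a : Fˣ × ℕ} (ha : 0 < a.2) : liLetter a ∈ liTopSpan F a.2 := by
  simpa using liLetter_mul_mem_liTopSpan ha (nestedSum_mem_liSpan IsWord.nil)

theorem mul_mem_liTopSpan {m n : ℕ} {f g : ℕ → RatFunc F} (hf : f ∈ liTopSpan F m)
    (hg : g ∈ liSpan F n) : f * g ∈ liTopSpan F (m + n) := by
  induction hf using Submodule.span_induction with
  | mem f hf =>
    obtain ⟨a, W, hW, rfl⟩ := hf
    obtain ⟨ha, k, hW', rfl⟩ := isWord_cons.mp hW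
    rw [mul_assoc, add_assoc]
    exact liLetter_mul_mem_liTopSpan ha (mul_mem_liSpan (nestedSum_mem_liSpan hW') hg)
  | zero => rw [zero_mul]; exact zero_mem _
  | add f g _ _ hf hg => rw [add_mul]; exact add_mem hf hg
  | smul c f _ hf => rw [smul_mul_assoc]; exact Submodule.smul_mem _ c hf

theorem mul_mem_liTopSpan_of_top {m n : ℕ} {f g : ℕ → RatFunc F} (hf : f ∈ liTopSpan F m)
    (hg : g ∈ liTopSpan F n) : f * g ∈ liTopSpan F (m + n) := by
  induction hf, hg using Submodule.span_induction₂ with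
  | mem_mem f g hf hg =>
    obtain ⟨a, U, hU, rfl⟩ := hf
    obtain ⟨b, V, hV, rfl⟩ := hg
    obtain ⟨ha, k, hU', rfl⟩ := isWord_cons.mp hU
    obtain ⟨hb, l, hV', rfl⟩ := isWord_cons.mp hV
    rw [mul_mul_mul_comm, liLetter_mul, add_add_add_comm]
    exact liLetter_mul_mem_liTopSpan (a := (a.1 * b.1, a.2 + b.2)) (by simp [ha])
      (nestedSum_mul_mem_liSpan hU' hV')
  | zero_left => rw [zero_mul]; exact zero_mem _
  | zero_right => rw [mul_zero]; exact zero_mem _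
  | add_left f g h _ _ _ h1 h2 => rw [add_mul]; exact add_mem h1 h2
  | add_right f g h _ _ _ h1 h2 => rw [mul_add]; exact add_mem h1 h2
  | smul_left c f g _ _ h => rw [smul_mul_assoc]; exact Submodule.smul_mem _ c h
  | smul_right c f g _ _ h => rw [mul_smul_comm]; exact Submodule.smul_mem _ c h

theorem pow_succ_mem_liTopSpan {w : ℕ} {f : ℕ → RatFunc F} (hf : f ∈ liTopSpan F w) (n : ℕ) :
    f ^ (n + 1) ∈ liTopSpan F (w * (n + 1)) := by
  induction n with
  | zero => simpa using hf
  | succ n ih =>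
    rw [pow_succ, mul_add_one w]
    exact mul_mem_liTopSpan_of_top ih hf

theorem weightedSum_one_mem_liSpan {w : ℕ} {f : ℕ → RatFunc F} (hf : f ∈ liTopSpan F w) :
    weightedSum 1 f ∈ liSpan F w := by
  induction hf using Submodule.span_induction with
  | mem f hf =>
    obtain ⟨a, W, hW, rfl⟩ := hf
    convert nestedSum_mem_liSpan hW using 1
    ext d
    simp [nestedSum_cons, weightedSum_apply]
  | zero => rw [map_zero]; exact zero_mem _
  | add f g _ _ hf hg => rw [map_add]; exact add_mem hf hg
  | smul c f _ hf => rw [map_smul]; exact Submodule.smul_mem _ c hf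

/-- The function `d ↦ ℓ_{d-i}^{-q^i}` is a combination of polylogarithmic sums of weight `q^i`. -/
theorem ellTwist_mem_liTopSpan (i : ℕ) : ellTwist F i ∈ liTopSpan F (q ^ i) := by
  induction i with
  | zero =>
    have h : ellTwist F 0 = liLetter (1, 1) := by
      ext d
      simp [ellTwist, liLetter]
    rw [h, pow_zero]
    exact liLetter_mem_liTopSpan (a := ((1 : Fˣ), 1)) one_pos
  | succ i ih =>
    have hq : 1 < q := Fintype.one_lt_card
    have h := mul_mem_liTopSpan ih
      (weightedSum_one_mem_liSpan (pow_succ_mem_liTopSpan ih (q - 1 - 1)))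
    have h2 : ellTwist F (i + 1) = ell F 1 ^ q ^ i •
        (ellTwist F i * weightedSum 1 (ellTwist F i ^ (q - 1 - 1 + 1))) := by
      ext d
      rw [ellTwist_succ]
      simp [weightedSum_apply, Nat.sub_add_cancel (Nat.le_sub_one_of_lt hq)]
    rw [h2]
    convert Submodule.smul_mem _ _ h using 2
    rw [Nat.sub_add_cancel (Nat.le_sub_one_of_lt hq), pow_succ]
    obtain ⟨m, hm⟩ : ∃ m, q = m + 1 := ⟨q - 1, by omega⟩
    rw [hm]; simp; ring

end Words

/-! ### Rewriting words with large letters -/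

section Reduction

variable {F : Type*} [Field F]

/-- The words occurring in the quasi-shuffle product of the one-letter word `a` with a word. -/
def insertions (a : Fˣ × ℕ) : List (Fˣ × ℕ) → List (List (Fˣ × ℕ))
  | [] => [[a]]
  | b :: W => (a :: b :: W) :: ((a.1 * b.1, a.2 + b.2) :: W) :: (insertions a W).map (b :: ·)

theorem isWord_of_mem_insertions {a : Fˣ × ℕ} (ha : 0 < a.2) {w : ℕ} {W X : List (Fˣ × ℕ)}
    (hW : IsWord w W) (hX : X ∈ insertions a W) : IsWord (a.2 + w) X := by
  induction W generalizing w X with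
  | nil =>
    obtain rfl : X = [a] := by simpa [insertions] using hX
    exact isWord_cons.mpr ⟨ha, w, hW, rfl⟩
  | cons b W ih =>
    obtain ⟨hb, m, hW', rfl⟩ := isWord_cons.mp hW
    simp only [insertions, List.mem_cons, List.mem_map] at hX
    rcases hX with rfl | rfl | ⟨Y, hY, rfl⟩
    · exact isWord_cons.mpr ⟨ha, _, hW, rfl⟩
    · exact isWord_cons.mpr ⟨by simp [ha], m, hW', by simp [add_assoc]⟩
    · exact isWord_cons.mpr ⟨hb, _, ih hW' hY, by ring⟩

theorem length_le_of_mem_insertions {a : Fˣ × ℕ} {W X : List (Fˣ × ℕ)}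
    (hX : X ∈ insertions a W) : max 1 W.length ≤ X.length := by
  induction W generalizing X with
  | nil =>
    obtain rfl : X = [a] := by simpa [insertions] using hX
    simp
  | cons b W ih =>
    simp only [insertions, List.mem_cons, List.mem_map] at hX
    rcases hX with rfl | rfl | ⟨Y, hY, rfl⟩
    · simp
    · simp
    · have := ih hY
      simp only [List.length_cons]
      omega

/-- The number with base `B` digits `n, s_1, …, s_r`. -/
def digitValue (B n : ℕ) (W : List (Fˣ × ℕ)) : ℕ :=
  W.foldl (fun n a => n * B + a.2) n

theorem digitValue_bounds {B : ℕ} (n : ℕ) {W : List (Fˣ × ℕ)} (hW : ∀ a ∈ W, a.2 < B) :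
    n * B ^ W.length ≤ digitValue B n W ∧ digitValue B n W < (n + 1) * B ^ W.length := by
  induction W generalizing n with
  | nil => simp [digitValue]
  | cons a W ih =>
    obtain ⟨h1, h2⟩ := ih (n * B + a.2) fun b hb => hW b (by simp [hb])
    have h3 : a.2 + 1 ≤ B := hW a (by simp)
    change n * B ^ (W.length + 1) ≤ digitValue B (n * B + a.2) W ∧
      digitValue B (n * B + a.2) W < (n + 1) * B ^ (W.length + 1)
    constructor
    · calc n * B ^ (W.length + 1) = (n * B) * B ^ W.length := by ring
        _ ≤ (n * B + a.2) * B ^ W.length := Nat.mul_le_mul_right _ (by omega)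
        _ ≤ _ := h1
    · calc _ < (n * B + a.2 + 1) * B ^ W.length := h2
        _ ≤ ((n + 1) * B) * B ^ W.length := Nat.mul_le_mul_right _ (by linarith)
        _ = _ := by ring

theorem IsWord.snd_le {w : ℕ} {W : List (Fˣ × ℕ)} (h : IsWord w W) {a : Fˣ × ℕ} (ha : a ∈ W) :
    a.2 ≤ w := by
  rw [← h.weight_eq]
  exact List.single_le_sum (by simp) _ (List.mem_map_of_mem ha)

theorem IsWord.length_le {w : ℕ} {W : List (Fˣ × ℕ)} (h : IsWord w W) : W.length ≤ w := by
  induction W generalizing w with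
  | nil => simp
  | cons a W ih =>
    obtain ⟨ha, m, hW, rfl⟩ := isWord_cons.mp h
    have := ih hW
    simp only [List.length_cons]
    omega

/-- A numerical rank on words of weight at most `w` which orders them first by length, then
lexicographically. -/
def wordRank (w : ℕ) (W : List (Fˣ × ℕ)) : ℕ :=
  W.length * (w + 1) ^ w + digitValue (w + 1) 0 W

theorem wordRank_le {w : ℕ} {W : List (Fˣ × ℕ)} (h : IsWord w W) :
    wordRank w W < (W.length + 1) * (w + 1) ^ w := by
  have h1 := (digitValue_bounds (B := w + 1) 0 fun a ha => Nat.lt_succ_of_le (h.snd_le ha)).2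
  have h2 : (w + 1) ^ W.length ≤ (w + 1) ^ w := Nat.pow_le_pow_right (by omega) h.length_le
  rw [wordRank, add_mul, one_mul]
  omega

theorem wordRank_lt_of_length_lt {w : ℕ} {W X : List (Fˣ × ℕ)} (h : IsWord w W)
    (hl : W.length < X.length) : wordRank w W < wordRank w X :=
  calc _ < (W.length + 1) * (w + 1) ^ w := wordRank_le h
    _ ≤ X.length * (w + 1) ^ w := Nat.mul_le_mul_right _ hl
    _ ≤ _ := Nat.le_add_right _ _

theorem wordRank_lt_of_letter_lt {w : ℕ} {U V X : List (Fˣ × ℕ)} {a b : Fˣ × ℕ}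
    (hV : IsWord w (U ++ a :: V)) (hX : IsWord w (U ++ b :: X)) (hab : a.2 < b.2)
    (hl : V.length ≤ X.length) : wordRank w (U ++ a :: V) < wordRank w (U ++ b :: X) := by
  rcases hl.lt_or_eq with hl | hl
  · exact wordRank_lt_of_length_lt hV (by simpa using hl)
  · have h (c : Fˣ × ℕ) (Y : List (Fˣ × ℕ)) : digitValue (w + 1) 0 (U ++ c :: Y) =
        digitValue (w + 1) (digitValue (w + 1) 0 U * (w + 1) + c.2) Y := by
      simp [digitValue, List.foldl_append]
    have h1 := (digitValue_bounds (B := w + 1) (W := V)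
      (digitValue (w + 1) 0 U * (w + 1) + a.2)
      fun c hc => Nat.lt_succ_of_le (hV.snd_le (by simp [hc]))).2
    have h2 := (digitValue_bounds (B := w + 1) (W := X)
      (digitValue (w + 1) 0 U * (w + 1) + b.2)
      fun c hc => Nat.lt_succ_of_le (hX.snd_le (by simp [hc]))).1
    have h3 : (digitValue (w + 1) 0 U * (w + 1) + a.2 + 1) * (w + 1) ^ V.length ≤
        (digitValue (w + 1) 0 U * (w + 1) + b.2) * (w + 1) ^ V.length :=
      Nat.mul_le_mul_right _ (by omega)
    rw [← hl] at h2
    simp only [wordRank, h, List.length_append, List.length_cons, hl] at *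
    omega

variable [Fintype F]

local notation "q" => Fintype.card F

theorem nestedSum_singleton_mul (a : Fˣ × ℕ) (W : List (Fˣ × ℕ)) :
    nestedSum liLetter [a] * nestedSum liLetter W =
      ((insertions a W).map (nestedSum liLetter)).sum := by
  induction W with
  | nil => simp [insertions]
  | cons b W ih =>
    have h : ((insertions a W).map (fun X => nestedSum liLetter (b :: X))).sum =
        weightedSum (liLetter b) ((insertions a W).map (nestedSum liLetter)).sum := by
      rw [map_list_sum, List.map_map]
      rfl
    simp only [insertions, List.map_cons, List.sum_cons, List.map_map, Function.comp_def]
    rw [h, ← ih, nestedSum_cons _ a [], nestedSum_cons _ b W, weightedSum_mul_weightedSum,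
      liLetter_mul, nestedSum_nil, one_mul, one_mul, nestedSum_cons _ a (b :: W),
      nestedSum_cons _ b W, nestedSum_cons _ _ W]
    abel

theorem nestedSum_apply_zero {W : List (Fˣ × ℕ)} (hW : W ≠ []) :
    nestedSum liLetter W 0 = 0 := by
  cases W with
  | nil => exact absurd rfl hW
  | cons a W => simp [nestedSum_cons, weightedSum_apply]

theorem liLetter_card (η : Fˣ) (d : ℕ) :
    liLetter (η, q) d = ell F 1 * RatFunc.C (η : F)⁻¹ *
      (liLetter (η, 1) (d + 1) * nestedSum liLetter [((1 : Fˣ), q - 1)] (d + 1)) := by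
  have hη : RatFunc.C (η : F)⁻¹ * RatFunc.C (η : F) = 1 := by
    rw [← map_mul, inv_mul_cancel₀ η.ne_zero, map_one]
  have h : nestedSum liLetter [((1 : Fˣ), q - 1)] (d + 1) =
      ∑ j ∈ range (d + 1), (ell F j)⁻¹ ^ (q - 1) := by
    simp [nestedSum_cons, weightedSum_apply, liLetter]
  rw [h]
  simp only [liLetter, inv_ell_pow_card, pow_succ, pow_zero, one_mul]
  linear_combination -(RatFunc.C (η : F) ^ d * ell F 1 * (ell F (d + 1))⁻¹ *
    (∑ j ∈ range (d + 1), (ell F j)⁻¹ ^ (q - 1))) * hη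

/-- The fundamental relation multiplied by the nested sum of a word `W` and summed over the outer
index. The shift `d ↦ d + 1` in the fundamental relation is the source of the terms
`liLetter (η, 1) * nestedSum liLetter X`. -/
theorem weightedSum_liLetter_card (η : Fˣ) (W : List (Fˣ × ℕ)) :
    weightedSum (liLetter (η, q)) (fun d => nestedSum liLetter W (d + 1)) =
      (ell F 1 * RatFunc.C (η : F)⁻¹) • ((insertions (1, q - 1) W).map fun X =>
        nestedSum liLetter ((η, 1) :: X) + liLetter (η, 1) * nestedSum liLetter X).sum := by
  have h1 : ((insertions (1, q - 1) W).map fun X =>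
      nestedSum liLetter ((η, 1) :: X) + liLetter (η, 1) * nestedSum liLetter X).sum =
      weightedSum (liLetter (η, 1)) ((insertions (1, q - 1) W).map (nestedSum liLetter)).sum +
        liLetter (η, 1) * ((insertions (1, q - 1) W).map (nestedSum liLetter)).sum := by
    rw [map_list_sum, List.sum_map_add, List.sum_map_mul_left, List.map_map]
    rfl
  rw [h1, ← nestedSum_singleton_mul]
  ext d
  simp only [weightedSum_apply, Pi.smul_apply, Pi.add_apply, Pi.mul_apply, smul_eq_mul]
  rw [← sum_range_succ (fun j => liLetter (η, 1) j *
    (nestedSum liLetter [((1 : Fˣ), q - 1)] j * nestedSum liLetter W j)), sum_range_succ',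
    nestedSum_apply_zero (W := [((1 : Fˣ), q - 1)]) (by simp), zero_mul, mul_zero, add_zero,
    mul_sum]
  refine sum_congr rfl fun j _ => ?_
  rw [liLetter_card]
  ring

/-- Rewriting a letter that is too large: either `s > q`, or `s = q` in the last position. In the
first case the relation is multiplied by the nested sum of `(1, s - q) V`, whose diagonal part
restores the letter `(η, s)` and whose off-diagonal part is the term `y`; in the second case it is
used as it stands. -/
theorem nestedSum_cons_of_card_le (η : Fˣ) {s m : ℕ} {V : List (Fˣ × ℕ)} (hV : IsWord m V)
    (hs : q < s ∨ (V = [] ∧ s = q)) :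
    ∃ (S : List (List (Fˣ × ℕ))) (c : RatFunc F) (y : ℕ → RatFunc F),
      (∀ X ∈ S, IsWord (s - 1 + m) X ∧ V.length + 1 ≤ X.length) ∧
      (y = 0 ∨ (q < s ∧ y = -nestedSum liLetter ((η, q) :: (1, s - q) :: V))) ∧
      nestedSum liLetter ((η, s) :: V) = y + c • (S.map fun X =>
        nestedSum liLetter ((η, 1) :: X) + liLetter (η, 1) * nestedSum liLetter X).sum := by
  have hq : 1 < q := Fintype.one_lt_card
  rcases hs with hs | ⟨rfl, rfl⟩
  · refine ⟨insertions (1, q - 1) ((1, s - q) :: V), ell F 1 * RatFunc.C (η : F)⁻¹, _,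
      fun X hX => ⟨?_, ?_⟩, Or.inr ⟨hs, rfl⟩, ?_⟩
    · have h := isWord_of_mem_insertions (a := ((1 : Fˣ), q - 1)) (by simpa using hq)
        (isWord_cons.mpr ⟨(by simpa using hs : 0 < ((1 : Fˣ), s - q).2), m, hV, rfl⟩) hX
      convert h using 1
      simp only
      omega
    · simpa using length_le_of_mem_insertions hX
    · rw [← weightedSum_liLetter_card]
      ext d
      simp only [nestedSum_cons _ _ V, nestedSum_cons _ _ ((1, s - q) :: V), Pi.add_apply,
        Pi.neg_apply, weightedSum_apply, ← sum_neg_distrib, ← sum_add_distrib]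
      refine sum_congr rfl fun j _ => ?_
      have h : liLetter (η, q) j * liLetter ((1 : Fˣ), s - q) j = liLetter (η, s) j := by
        rw [← Pi.mul_apply, liLetter_mul]
        simp [Nat.add_sub_cancel' hs.le]
      rw [sum_range_succ, ← h]
      ring
  · refine ⟨insertions (1, q - 1) [], ell F 1 * RatFunc.C (η : F)⁻¹, 0,
      fun X hX => ⟨?_, ?_⟩, Or.inl rfl, ?_⟩
    · exact isWord_of_mem_insertions (by simpa using hq) hV hX
    · simpa using length_le_of_mem_insertions hX
    · rw [zero_add, ← weightedSum_liLetter_card]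
      rfl

/-- The words corresponding to the arrays with `s_1, …, s_{r-1} ≤ q` and `s_r < q`. -/
def IsGood (W : List (Fˣ × ℕ)) : Prop :=
  ∀ U a V, W = U ++ a :: V → a.2 ≤ q ∧ (V = [] → a.2 < q)

variable (F) in
/-- The span of the nested sums of the words of weight `w` with `s_1, …, s_{r-1} ≤ q` and
`s_r < q`. -/
def goodSpan (w : ℕ) : Submodule (RatFunc F) (ℕ → RatFunc F) :=
  Submodule.span _ {f | ∃ W : List (Fˣ × ℕ), IsWord w W ∧ IsGood W ∧ nestedSum liLetter W = f}

theorem exists_of_not_isGood {W : List (Fˣ × ℕ)} (h : ¬ IsGood W) :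
    ∃ U a V, W = U ++ a :: V ∧ (q < a.2 ∨ (V = [] ∧ a.2 = q)) := by
  simp only [IsGood, not_forall] at h
  obtain ⟨U, a, V, hW, h⟩ := h
  refine ⟨U, a, V, hW, ?_⟩
  by_cases h1 : a.2 ≤ q
  · right
    have h2 : ¬ (V = [] → a.2 < q) := fun h2 => h ⟨h1, h2⟩
    push Not at h2
    exact ⟨h2.1, le_antisymm h1 h2.2⟩
  · left; omega

/-- Rewriting a bad letter produces words of higher rank: they are longer or, at equal length,
lexicographically larger. As the rank is bounded in a given weight, repeated rewriting ends with
good words. When the bad letter comes first, the shift in the fundamental relation leaves a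
remainder in `liTopSpan`; its elements tend to zero and do not contribute to the limit. -/
theorem nestedSum_mem_goodSpan_sup {w : ℕ} {W : List (Fˣ × ℕ)} (hW : IsWord w W) :
    nestedSum liLetter W ∈ goodSpan F w ⊔ liTopSpan F w := by
  induction hn : (w + 1) * (w + 1) ^ w - wordRank w W using Nat.strong_induction_on
    generalizing W with
  | _ n ih =>
  have IH (X : List (Fˣ × ℕ)) (hX : IsWord w X) (hlt : wordRank w W < wordRank w X) :
      nestedSum liLetter X ∈ goodSpan F w ⊔ liTopSpan F w := by
    have h1 : (X.length + 1) * (w + 1) ^ w ≤ (w + 1) * (w + 1) ^ w :=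
      Nat.mul_le_mul_right _ (by have := hX.length_le; omega)
    have h2 := wordRank_le hX
    exact ih _ (by omega) hX rfl
  clear ih hn
  by_cases hgood : IsGood W
  · exact Submodule.mem_sup_left (Submodule.subset_span ⟨W, hW, hgood, rfl⟩)
  obtain ⟨U, ⟨η, s⟩, V, rfl, hs⟩ := exists_of_not_isGood hgood
  obtain ⟨k, l, hU, hV', rfl⟩ := isWord_append.mp hW
  obtain ⟨hs0, m, hV, rfl⟩ := isWord_cons.mp hV'
  simp only at hs hs0 IH ⊢
  obtain ⟨S, c, y, hS, hy, hrel⟩ := nestedSum_cons_of_card_le η hV hs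
  have hq : 1 < q := Fintype.one_lt_card
  rw [← prefixMap_nestedSum, hrel, map_add, map_smul, map_list_sum, List.map_map]
  refine add_mem ?_ (Submodule.smul_mem _ _ (list_sum_mem fun z hz => ?_))
  · rcases hy with rfl | ⟨hlt, rfl⟩
    · rw [map_zero]; exact zero_mem _
    · rw [map_neg, prefixMap_nestedSum]
      refine neg_mem (IH _ ?_ (wordRank_lt_of_length_lt hW (by simp)))
      refine isWord_append.mpr ⟨k, s + m, hU, isWord_cons.mpr ⟨by simp; omega, s - q + m,
        isWord_cons.mpr ⟨by simpa using hlt, m, hV, rfl⟩, by simp; omega⟩, rfl⟩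
  · obtain ⟨X, hXS, rfl⟩ := List.mem_map.mp hz
    obtain ⟨hX, hXl⟩ := hS X hXS
    rw [Function.comp_apply, map_add]
    refine add_mem ?_ ?_
    · rw [prefixMap_nestedSum]
      refine IH _ (isWord_append.mpr ⟨k, s + m, hU, isWord_cons.mpr
        ⟨one_pos, _, hX, by simp; omega⟩, rfl⟩) (wordRank_lt_of_length_lt hW ?_)
      simp only [List.length_append, List.length_cons]
      omega
    · rcases List.eq_nil_or_concat' U with rfl | ⟨U, ⟨σ, u⟩, rfl⟩
      · obtain rfl : 0 = k := hU.weight_eq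
        refine Submodule.mem_sup_right (Submodule.subset_span ⟨(η, 1), X, ?_, rfl⟩)
        exact isWord_cons.mpr ⟨one_pos, _, hX, by simp; omega⟩
      · -- The remainder merges with the last letter `(σ, u)` of the prefix into `(ση, u + 1)`.
        rw [prefixMap_append_singleton]
        obtain ⟨i, j, hU1, hU2, rfl⟩ := isWord_append.mp hU
        obtain ⟨hu, t, ht, rfl⟩ := isWord_cons.mp hU2
        obtain rfl : 0 = t := ht.weight_eq
        have h1 : weightedSum (liLetter (σ, u)) (liLetter (η, 1) * nestedSum liLetter X) =
            nestedSum liLetter ((σ * η, u + 1) :: X) := by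
          rw [nestedSum_cons, ← liLetter_mul (σ, u) (η, 1)]
          ext d
          simp [weightedSum_apply, mul_assoc]
        have h2 : IsWord (i + (u + 0) + (s + m)) (U ++ (σ * η, u + 1) :: X) :=
          isWord_append.mpr ⟨i, u + s + m, hU1, isWord_cons.mpr
            ⟨by simp, _, hX, by simp; omega⟩, by ring⟩
        rw [h1, prefixMap_nestedSum]
        refine IH _ h2 ?_
        rw [List.append_assoc] at hW ⊢
        exact wordRank_lt_of_letter_lt hW h2 (by simp) (by simpa using hXl)

end Reduction

/-! ### Power sums of monic polynomials -/

section Carlitz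

variable (F : Type*) [Field F] [Fintype F]

local notation "q" => Fintype.card F
local notation "θ" => (RatFunc.X : RatFunc F)

/-- The inverses `1 / D_i` of the products `D_i` of all monic polynomials of degree `i`, given by
Carlitz's recursion `D_{i+1} = (θ^{q^{i+1}} - θ) D_i^q`. -/
def carlitzCoeff : ℕ → RatFunc F
  | 0 => 1
  | i + 1 => carlitzCoeff i ^ q / (θ ^ q ^ (i + 1) - θ)

theorem carlitzCoeff_succ_mul (i : ℕ) :
    carlitzCoeff F (i + 1) * (θ ^ q ^ (i + 1) - θ) = carlitzCoeff F i ^ q := by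
  rw [carlitzCoeff, div_mul_cancel₀]
  rw [← neg_sub]
  exact neg_ne_zero.mpr (X_sub_X_pow_ne_zero F (by omega))

/-- The `F`-linear operator `E_d(x) = ∑_i x^{q^i} / (D_i ℓ_{d-i}^{q^i})`. It kills the polynomials
of degree less than `d` and takes the value `1` at monic polynomials of degree `d`. -/
def carlitzMap (d : ℕ) : RatFunc F →ₗ[F] RatFunc F :=
  ∑ i ∈ range (d + 1), (carlitzCoeff F i * ellTwist F i d) •
    ((FiniteField.frobeniusAlgHom F (RatFunc F)) ^ i).toLinearMap

theorem carlitzMap_apply (d : ℕ) (x : RatFunc F) :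
    carlitzMap F d x =
      ∑ i ∈ range (d + 1), carlitzCoeff F i * ellTwist F i d * x ^ q ^ i := by
  simp only [carlitzMap, LinearMap.coe_sum, Finset.sum_apply, LinearMap.smul_apply,
    AlgHom.toLinearMap_apply, smul_eq_mul, AlgHom.coe_pow, FiniteField.coe_frobeniusAlgHom,
    pow_iterate]

/-- The factor `θ^{q^i} - θ` vanishes for `i = 0`, and `1 / D_{i-1}^q = (θ^{q^i} - θ) / D_i` for
`i ≥ 1`. -/
theorem carlitzMap_pow_card (d : ℕ) (x : RatFunc F) :
    carlitzMap F d x ^ q = ∑ i ∈ range (d + 2),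
      carlitzCoeff F i * ellTwist F i (d + 1) * (θ ^ q ^ i - θ) * x ^ q ^ i := by
  rw [carlitzMap_apply, sum_pow_card, sum_range_succ' _ (d + 1), pow_zero, pow_one, sub_self,
    mul_zero, zero_mul, add_zero]
  refine sum_congr rfl fun i _ => ?_
  rw [mul_pow, mul_pow, ← carlitzCoeff_succ_mul, ← pow_mul, ← pow_succ, ellTwist]
  ring

theorem carlitzMap_X_mul (d : ℕ) (x : RatFunc F) :
    carlitzMap F (d + 1) (θ * x) = θ * carlitzMap F (d + 1) x + carlitzMap F d x ^ q := by
  rw [carlitzMap_pow_card, carlitzMap_apply, carlitzMap_apply, mul_sum, ← sum_add_distrib]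
  refine sum_congr rfl fun i _ => ?_
  rw [mul_pow]
  ring

theorem carlitzMap_succ_mul (d : ℕ) (x : RatFunc F) :
    carlitzMap F (d + 1) x * (θ ^ q ^ (d + 1) - θ) = carlitzMap F d x ^ q - carlitzMap F d x := by
  have h : carlitzMap F d x =
      ∑ i ∈ range (d + 2), carlitzCoeff F i * ellTwist F i d * x ^ q ^ i := by
    rw [sum_range_succ, ellTwist_of_lt F (Nat.lt_succ_self d), mul_zero, zero_mul, add_zero,
      carlitzMap_apply]
  rw [carlitzMap_pow_card, h, carlitzMap_apply, sum_mul, ← sum_sub_distrib]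
  refine sum_congr rfl fun i _ => ?_
  rw [ellTwist_eq_succ_mul F i d]
  ring

theorem carlitzMap_zero_one : carlitzMap F 0 1 = 1 := by
  simp [carlitzMap_apply, carlitzCoeff, ellTwist, ell_zero]

theorem carlitzMap_succ_one (d : ℕ) : carlitzMap F (d + 1) 1 = 0 := by
  have h0 : θ ^ q ^ (d + 1) - θ ≠ 0 := by
    rw [← neg_sub]
    exact neg_ne_zero.mpr (X_sub_X_pow_ne_zero F (by omega))
  have h := carlitzMap_succ_mul F d 1
  have h1 : carlitzMap F d 1 ^ q = carlitzMap F d 1 := by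
    cases d with
    | zero => rw [carlitzMap_zero_one, one_pow]
    | succ d => rw [carlitzMap_succ_one d, zero_pow Fintype.card_ne_zero]
  rw [h1, sub_self] at h
  exact (mul_eq_zero.mp h).resolve_right h0

theorem carlitzMap_X_pow (j d : ℕ) :
    (j < d → carlitzMap F d (θ ^ j) = 0) ∧ (j = d → carlitzMap F d (θ ^ j) = 1) := by
  induction j generalizing d with
  | zero =>
    cases d with
    | zero => simp [carlitzMap_zero_one]
    | succ d => simp [carlitzMap_succ_one]
  | succ j ih =>
    cases d with
    | zero => simp
    | succ d =>
      rw [pow_succ', carlitzMap_X_mul]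
      constructor
      · intro h
        rw [(ih (d + 1)).1 (by omega), (ih d).1 (by omega), mul_zero,
          zero_pow Fintype.card_ne_zero, add_zero]
      · intro h
        rw [(ih (d + 1)).1 (by omega), (ih d).2 (by omega), mul_zero, one_pow, zero_add]

theorem carlitzMap_monic {d : ℕ} {P : Polynomial F} (hP : P.Monic) (hd : P.natDegree = d) :
    carlitzMap F d (algebraMap (Polynomial F) (RatFunc F) P) = 1 := by
  have h : algebraMap (Polynomial F) (RatFunc F) P =
      ∑ i ∈ range (d + 1), P.coeff i • θ ^ i := by
    conv_lhs => rw [P.as_sum_range_C_mul_X_pow, hd]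
    simp [RatFunc.algebraMap_C, RatFunc.algebraMap_X, RatFunc.smul_eq_C_mul]
  rw [h, map_sum, sum_range_succ, sum_eq_zero, zero_add, map_smul, (carlitzMap_X_pow F d d).2 rfl,
    ← hd, hP.coeff_natDegree, one_smul]
  intro i hi
  rw [map_smul, (carlitzMap_X_pow F i d).1 (mem_range.mp hi), smul_zero]

/-- The finite set of monic polynomials of degree `d`, parametrized by their lower coefficients. -/
def monics (d : ℕ) : Finset (Polynomial F) :=
  univ.map ((((Polynomial.degreeLTEquiv F d).symm.toEquiv.trans
    (Polynomial.monicEquivDegreeLT d).symm).toEmbedding.trans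
    (Function.Embedding.subtype _)) : (Fin d → F) ↪ Polynomial F)

variable {F} in
theorem mem_monics {d : ℕ} {P : Polynomial F} : P ∈ monics F d ↔ P.Monic ∧ P.natDegree = d := by
  simp only [monics, mem_map, mem_univ, true_and]
  constructor
  · rintro ⟨v, rfl⟩
    exact ((Polynomial.monicEquivDegreeLT d).symm _).2
  · intro h
    refine ⟨((Polynomial.degreeLTEquiv F d).symm.toEquiv.trans
      (Polynomial.monicEquivDegreeLT d).symm).symm ⟨P, h⟩, ?_⟩
    simp

theorem card_monics (d : ℕ) : (monics F d).card = q ^ d := by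
  simp [monics]

/-- The power sum `S_d(k) = ∑ 1 / a^k` over the monic polynomials `a` of degree `d`. -/
def powerSum (k d : ℕ) : RatFunc F :=
  ∑ P ∈ monics F d, (algebraMap (Polynomial F) (RatFunc F) P)⁻¹ ^ k

/-- The polynomial `1 - E_d(x)`. -/
def carlitzPoly (d : ℕ) : Polynomial (RatFunc F) :=
  1 - ∑ i ∈ range (d + 1),
    Polynomial.C (carlitzCoeff F i * ellTwist F i d) * Polynomial.X ^ q ^ i

/-- Both sides have degree at most `q^d` and agree at `0` and at the `q^d` monic polynomials of
degree `d`. -/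
theorem carlitzPoly_eq_prod (d : ℕ) :
    carlitzPoly F d = ∏ P ∈ monics F d,
      (1 - Polynomial.C (algebraMap (Polynomial F) (RatFunc F) P)⁻¹ * Polynomial.X) := by
  classical
  have hq : 1 < q := Fintype.one_lt_card
  have hne : ∀ P ∈ monics F d, algebraMap (Polynomial F) (RatFunc F) P ≠ 0 := fun P hP => by
    simpa using (mem_monics.mp hP).1.ne_zero
  have h0 : (0 : RatFunc F) ∉ (monics F d).image (algebraMap (Polynomial F) (RatFunc F)) := by
    simp only [mem_image, not_exists, not_and]
    exact hne
  have hcard : (insert 0 ((monics F d).image (algebraMap (Polynomial F) (RatFunc F)))).card =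
      q ^ d + 1 := by
    rw [card_insert_of_notMem h0, card_image_of_injective _ (RatFunc.algebraMap_injective F),
      card_monics]
  have hlt : ((q ^ d : ℕ) : WithBot ℕ) < ((q ^ d + 1 : ℕ) : WithBot ℕ) := by
    exact_mod_cast Nat.lt_succ_self _
  apply Polynomial.eq_of_degrees_lt_of_eval_finset_eq
    (insert 0 ((monics F d).image (algebraMap (Polynomial F) (RatFunc F))))
  · rw [hcard]
    refine lt_of_le_of_lt ?_ hlt
    refine (Polynomial.degree_sub_le _ _).trans (max_le ?_ ?_)
    · exact Polynomial.degree_one_le.trans (by exact_mod_cast Nat.zero_le _)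
    · refine (Polynomial.degree_sum_le _ _).trans (Finset.sup_le fun i hi => ?_)
      refine (Polynomial.degree_C_mul_X_pow_le _ _).trans ?_
      exact_mod_cast Nat.pow_le_pow_right hq.le (by simpa [Nat.lt_succ_iff] using hi)
  · rw [hcard]
    refine lt_of_le_of_lt ?_ hlt
    refine (Polynomial.degree_prod_le _ _).trans ?_
    refine (Finset.sum_le_card_nsmul _ _ 1 fun P _ => ?_).trans ?_
    · refine (Polynomial.degree_sub_le _ _).trans (max_le ?_ ?_)
      · exact Polynomial.degree_one_le.trans zero_le_one
      · exact Polynomial.degree_C_mul_X_le _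
    · rw [card_monics]; simp
  · intro x hx
    rcases mem_insert.mp hx with rfl | hx
    · simp [carlitzPoly, Polynomial.eval_prod, Polynomial.eval_finsetSum]
    · obtain ⟨P, hP, rfl⟩ := mem_image.mp hx
      rw [Polynomial.eval_prod, prod_eq_zero hP (by simp [hne P hP]), carlitzPoly]
      simp only [Polynomial.eval_sub, Polynomial.eval_one, Polynomial.eval_finsetSum,
        Polynomial.eval_mul, Polynomial.eval_C, Polynomial.eval_pow, Polynomial.eval_X]
      rw [← carlitzMap_apply, carlitzMap_monic F (mem_monics.mp hP).1 (mem_monics.mp hP).2,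
        sub_self]

theorem derivative_carlitzPoly (d : ℕ) :
    Polynomial.derivative (carlitzPoly F d) = -Polynomial.C (ell F d)⁻¹ := by
  have h : ((q : ℕ) : RatFunc F) = 0 := by
    rw [← map_natCast (algebraMap F (RatFunc F)), FiniteField.cast_card_eq_zero, map_zero]
  rw [carlitzPoly, sum_range_succ']
  simp [carlitzCoeff, ellTwist, Polynomial.derivative_X_pow, h]

/-- The logarithmic derivative of `∏_a (1 - x / a) = 1 - E_d(x)`, as a recursion for the
coefficients `S_d(k)` of its expansion at `x = 0`. -/
theorem powerSum_succ (n d : ℕ) :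
    powerSum F (n + 1) d = (if n = 0 then (ell F d)⁻¹ else 0) +
      ∑ i ∈ range (n + 1), if q ^ i ≤ n then
        carlitzCoeff F i * ellTwist F i d * powerSum F (n - q ^ i + 1) d else 0 := by
  classical
  let u (P : Polynomial F) : RatFunc F := (algebraMap (Polynomial F) (RatFunc F) P)⁻¹
  let G : PowerSeries (RatFunc F) := PowerSeries.mk fun k => powerSum F (k + 1) d
  have hG : G = ∑ P ∈ monics F d, PowerSeries.mk fun k => u P ^ (k + 1) := by
    ext k
    simp [G, powerSum, u]
  have hgeom (x : RatFunc F) : (1 - PowerSeries.C x * PowerSeries.X) *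
      PowerSeries.mk (fun k => x ^ (k + 1)) = PowerSeries.C x := by
    ext k
    rw [sub_mul, one_mul, mul_assoc, map_sub, PowerSeries.coeff_C_mul, PowerSeries.coeff_mk]
    cases k with
    | zero => simp
    | succ k =>
      rw [PowerSeries.coeff_succ_X_mul, PowerSeries.coeff_mk, PowerSeries.coeff_C]
      simp [pow_succ']
  have hprod : (carlitzPoly F d : PowerSeries (RatFunc F)) * G = PowerSeries.C (ell F d)⁻¹ := by
    have hder := derivative_carlitzPoly F d
    rw [carlitzPoly_eq_prod, Polynomial.derivative_prod_finset] at hder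
    rw [hG, mul_sum, ← Polynomial.coe_C, ← neg_neg (Polynomial.C (ell F d)⁻¹), ← hder,
      ← sum_neg_distrib, ← Polynomial.coeToPowerSeries.ringHom_apply
        (φ := ∑ P ∈ monics F d, _), map_sum]
    refine sum_congr rfl fun P hP => ?_
    rw [carlitzPoly_eq_prod, ← mul_prod_erase _ _ hP, Polynomial.coe_mul, mul_right_comm]
    have h1 := hgeom (u P)
    simp only [Polynomial.coeToPowerSeries.ringHom_apply, Polynomial.coe_sub, Polynomial.coe_one,
      Polynomial.coe_mul, Polynomial.coe_C, Polynomial.coe_X, Polynomial.derivative_sub,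
      Polynomial.derivative_one, Polynomial.derivative_C_mul, Polynomial.derivative_X, zero_sub,
      mul_one, mul_neg, neg_neg]
    rw [h1, mul_comm]
  -- The terms with `i > d` vanish because `ellTwist F i d = 0`, those with `i > n` because `q^i > n`.
  have hsum : ∑ i ∈ range (n + 1), (if q ^ i ≤ n then
      carlitzCoeff F i * ellTwist F i d * powerSum F (n - q ^ i + 1) d else 0) =
      ∑ i ∈ range (d + 1), (if q ^ i ≤ n then
        carlitzCoeff F i * ellTwist F i d * powerSum F (n - q ^ i + 1) d else 0) := by
    have hle (m : ℕ) (hmn : m ≤ n + d) (hm : ∀ i, m < i → (if q ^ i ≤ n then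
        carlitzCoeff F i * ellTwist F i d * powerSum F (n - q ^ i + 1) d else 0) = 0) :
        ∑ i ∈ range (m + 1), (if q ^ i ≤ n then
          carlitzCoeff F i * ellTwist F i d * powerSum F (n - q ^ i + 1) d else 0) =
        ∑ i ∈ range (n + d + 1), (if q ^ i ≤ n then
          carlitzCoeff F i * ellTwist F i d * powerSum F (n - q ^ i + 1) d else 0) := by
      refine sum_subset (range_subset_range.mpr (by omega)) fun i _ hi => hm i ?_
      simpa using hi
    rw [hle n (by omega), hle d (by omega)]
    · intro i hi
      rw [ellTwist_of_lt F hi, mul_zero, zero_mul, ite_self]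
    · intro i hi
      have := (Nat.lt_pow_self (Fintype.one_lt_card (α := F))).trans' hi
      rw [if_neg (by omega)]
  have hcoef := congrArg (PowerSeries.coeff n) hprod
  rw [PowerSeries.coeff_C] at hcoef
  rw [hsum, ← hcoef, carlitzPoly, Polynomial.coe_sub, Polynomial.coe_one, sub_mul, one_mul,
    map_sub, ← Polynomial.coeToPowerSeries.ringHom_apply (φ := ∑ i ∈ range (d + 1), _), map_sum,
    sum_mul, map_sum]
  simp only [G, PowerSeries.coeff_mk]
  rw [sub_add, eq_comm, sub_eq_self, sub_eq_zero]
  refine sum_congr rfl fun i _ => ?_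
  rw [Polynomial.coeToPowerSeries.ringHom_apply, Polynomial.coe_mul, Polynomial.coe_C,
    Polynomial.coe_pow, Polynomial.coe_X, mul_assoc, PowerSeries.coeff_C_mul,
    PowerSeries.coeff_X_pow_mul']
  split_ifs <;> simp

/-- For `k ≤ q` only the term `i = 0` of the recursion contributes. -/
theorem powerSum_eq_inv_ell_pow {k : ℕ} (hk : 0 < k) (hkq : k ≤ q) (d : ℕ) :
    powerSum F k d = (ell F d)⁻¹ ^ k := by
  obtain ⟨n, rfl⟩ : ∃ n, k = n + 1 := ⟨k - 1, by omega⟩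
  clear hk
  induction n with
  | zero => simp [powerSum_succ]
  | succ n ih =>
    rw [powerSum_succ, if_neg (by omega), zero_add, sum_eq_single 0]
    · simp [ih (by omega), carlitzCoeff, ellTwist, pow_succ']
    · intro i _ hi
      have : q ≤ q ^ i := Nat.le_self_pow hi q
      rw [if_neg (by omega)]
    · simp

/-- The recursion for `S_d(k)` involves only multiplication by the functions
`d ↦ ℓ_{d-i}^{-q^i}`. -/
theorem powerSum_mem_liTopSpan {k : ℕ} (hk : 0 < k) : powerSum F k ∈ liTopSpan F k := by
  induction k using Nat.strong_induction_on with
  | _ k ih =>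
  obtain ⟨n, rfl⟩ : ∃ n, k = n + 1 := ⟨k - 1, by omega⟩
  have h : powerSum F (n + 1) = (if n = 0 then ellTwist F 0 else 0) +
      ∑ i ∈ range (n + 1), if q ^ i ≤ n then
        carlitzCoeff F i • (ellTwist F i * powerSum F (n - q ^ i + 1)) else 0 := by
    ext d
    rw [powerSum_succ, Pi.add_apply, Finset.sum_apply]
    congr 1
    · split_ifs <;> rfl
    · refine sum_congr rfl fun i _ => ?_
      split_ifs
      · simp [mul_assoc]
      · rfl
  rw [h]
  refine add_mem ?_ (sum_mem fun i _ => ?_)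
  · split_ifs with h0
    · subst h0
      simpa using ellTwist_mem_liTopSpan (F := F) 0
    · exact zero_mem _
  · split_ifs with hi
    · have hpos : 0 < q ^ i := Nat.pow_pos Fintype.card_pos
      convert Submodule.smul_mem _ _ (mul_mem_liTopSpan_of_top (ellTwist_mem_liTopSpan (F := F) i)
        (ih (n - q ^ i + 1) (by omega) (by omega))) using 2
      omega
    · exact zero_mem _

end Carlitz

/-! ### Sums over tuples -/

section Tuples

open Classical in
/-- The tuples `(x_1, …, x_r)` with `x_i ∈ fib d_i` and `D > d_1 > ⋯ > d_r ≥ 0`. -/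
def tuplesBelow {ι : Type*} (fib : ℕ → Finset ι) : (r : ℕ) → ℕ → Finset (Fin r → ι)
  | 0, _ => {Fin.elim0}
  | r + 1, D => (range D).biUnion fun j =>
      (fib j ×ˢ tuplesBelow fib r j).image fun p => (Fin.cons p.1 p.2 : Fin (r + 1) → ι)

variable {ι : Type*} {fib : ℕ → Finset ι} {deg : ι → ℕ}

theorem mem_tuplesBelow (hfib : ∀ d, ∀ x ∈ fib d, deg x = d) {r D : ℕ} {x : Fin r → ι} :
    x ∈ tuplesBelow fib r D ↔
      (∀ i, x i ∈ fib (deg (x i))) ∧ StrictAnti (fun i => deg (x i)) ∧ ∀ i, deg (x i) < D := by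
  induction r generalizing D with
  | zero =>
    simp only [tuplesBelow, mem_singleton]
    exact ⟨fun _ => ⟨fun i => i.elim0, fun i => i.elim0, fun i => i.elim0⟩,
      fun _ => funext fun i => i.elim0⟩
  | succ r ih =>
    simp only [tuplesBelow, mem_biUnion, mem_range, mem_image, mem_product, Prod.exists]
    constructor
    · rintro ⟨j, hj, y, z, ⟨hy, hz⟩, rfl⟩
      obtain ⟨h1, h2, h3⟩ := ih.mp hz
      obtain rfl := hfib j y hy
      refine ⟨fun i => ?_, fun i k hik => ?_, fun i => ?_⟩
      · cases i using Fin.cases with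
        | zero => exact hy
        | succ i => exact h1 i
      · cases k using Fin.cases with
        | zero => exact absurd hik (Fin.not_lt_zero i)
        | succ k =>
          cases i using Fin.cases with
          | zero => exact h3 k
          | succ i => exact h2 (Fin.succ_lt_succ_iff.mp hik)
      · cases i using Fin.cases with
        | zero => exact hj
        | succ i => exact (h3 i).trans hj
    · rintro ⟨h1, h2, h3⟩
      refine ⟨deg (x 0), h3 0, x 0, fun i => x i.succ, ⟨h1 0, ih.mpr ⟨fun i => h1 _,
        fun i k hik => h2 (Fin.succ_lt_succ_iff.mpr hik), fun i => h2 (Fin.succ_pos i)⟩⟩,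
        Fin.cons_self_tail x⟩

/-- Grouping tuples by the degrees of their entries turns a sum of products into a nested sum. -/
theorem sum_tuplesBelow (hfib : ∀ d, ∀ x ∈ fib d, deg x = d) {K L : Type*} [Field K]
    (ψ : L → ι → K) {r : ℕ} (a : Fin r → L) (D : ℕ) :
    ∑ x ∈ tuplesBelow fib r D, ∏ i, ψ (a i) (x i) =
      nestedSum (fun a d => ∑ x ∈ fib d, ψ a x) (List.ofFn a) D := by
  classical
  induction r generalizing D with
  | zero => simp [tuplesBelow]
  | succ r ih =>
    rw [tuplesBelow, sum_biUnion, List.ofFn_succ, nestedSum_cons, weightedSum_apply]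
    · refine sum_congr rfl fun j _ => ?_
      rw [sum_image, sum_product, ← ih, sum_mul_sum]
      · simp [Fin.prod_univ_succ]
      · rintro ⟨y, z⟩ _ ⟨y', z'⟩ _ h
        obtain ⟨h1, h2⟩ := Fin.cons_inj.mp h
        exact Prod.ext h1 h2
    · intro j _ k _ hjk
      rw [Function.onFun, Finset.disjoint_left]
      intro x hx hx'
      simp only [mem_image, mem_product, Prod.exists] at hx hx'
      obtain ⟨y, z, ⟨hy, -⟩, rfl⟩ := hx
      obtain ⟨y', z', ⟨hy', -⟩, h⟩ := hx'
      have h1 : y' = y := (Fin.cons_inj.mp h).1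
      exact hjk ((hfib j y hy).symm.trans (h1 ▸ hfib k y' hy'))

end Tuples

/-! ### Convergence in the completion at infinity -/

section Valuation

open Filter Topology WithZero

variable {F : Type*} [Field F] [DecidableEq (RatFunc F)]

instance : CompleteSpace (RatFunc.CompletionAtInfty F) :=
  letI := RatFunc.inftyValued F
  inferInstanceAs (CompleteSpace (UniformSpace.Completion (RatFunc F)))

instance : NonarchimedeanAddGroup (RatFunc.CompletionAtInfty F) where
  is_nonarchimedean U hU := by
    obtain ⟨γ, hγ⟩ := Valued.mem_nhds_zero.mp hU
    let V : AddSubgroup (RatFunc.CompletionAtInfty F) :=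
      (Valued.v (R := RatFunc.CompletionAtInfty F)).restrict.ltAddSubgroup γ
    have hV : IsOpen (V : Set (RatFunc.CompletionAtInfty F)) :=
      V.isOpen_of_mem_nhds (g := 0) (Valued.mem_nhds_zero.mpr ⟨γ, subset_rfl⟩)
    exact ⟨⟨V, hV⟩, hγ⟩

theorem valued_algebraMap (x : RatFunc F) :
    Valued.v (algebraMap (RatFunc F) (RatFunc.CompletionAtInfty F) x) =
      RatFunc.inftyValuation F x := by
  rw [RatFunc.valuedCompletionAtInfty.def]
  exact Valued.extensionValuation_apply_coe (hv := RatFunc.inftyValued F) x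

theorem exists_valuation_le_subset {U : Set (RatFunc.CompletionAtInfty F)} (hU : U ∈ 𝓝 0) :
    ∃ D : ℕ, ∀ x : RatFunc.CompletionAtInfty F, Valued.v x ≤ exp (-(D : ℤ)) → x ∈ U := by
  obtain ⟨γ, hγ⟩ := Valued.mem_nhds_zero.mp hU
  have h0 : MonoidWithZeroHom.ValueGroup₀.embedding γ.1 ≠ 0 := by simp
  obtain ⟨n, hn⟩ : ∃ n : ℤ, MonoidWithZeroHom.ValueGroup₀.embedding γ.1 = exp n :=
    ⟨_, (exp_log h0).symm⟩
  refine ⟨n.natAbs + 1, fun x hx => hγ ?_⟩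
  rw [Set.mem_ofPred_eq, Valuation.restrict_lt_iff_lt_embedding, hn]
  refine hx.trans_lt (exp_lt_exp.mpr ?_)
  omega

theorem tendsto_zero_of_valuation_le {f : ℕ → RatFunc.CompletionAtInfty F}
    (h : ∀ d, Valued.v (f d) ≤ exp (-(d : ℤ))) : Tendsto f atTop (𝓝 0) := by
  intro U hU
  obtain ⟨D, hD⟩ := exists_valuation_le_subset hU
  refine mem_atTop_sets.mpr ⟨D, fun d hd => hD _ ((h d).trans (exp_le_exp.mpr ?_))⟩
  omega

theorem summable_of_valuation_le {α : Type*} {f : α → RatFunc.CompletionAtInfty F}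
    (A : ℕ → Finset α) (h : ∀ D, ∀ x ∉ A D, Valued.v (f x) ≤ exp (-(D : ℤ))) : Summable f := by
  apply NonarchimedeanAddGroup.summable_of_tendsto_cofinite_zero
  intro U hU
  obtain ⟨D, hD⟩ := exists_valuation_le_subset hU
  refine mem_cofinite.mpr ((A D).finite_toSet.subset fun x hx => ?_)
  by_contra hxA
  exact hx (hD _ (h D x hxA))

theorem exp_neg_natCast_le_one (d : ℕ) : exp (-(d : ℤ)) ≤ (1 : ℤᵐ⁰) := by
  rw [← exp_zero]
  exact exp_le_exp.mpr (by omega)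

theorem inftyValuation_C_unit_pow (ε : Fˣ) (d : ℕ) :
    RatFunc.inftyValuation F (RatFunc.C (ε : F) ^ d) = 1 := by
  rw [map_pow, RatFunc.inftyValuation.C _ ε.ne_zero, one_pow]

/-- Convergence in `K_∞` of a sequence in `K`. -/
def ConvergesTo (f : ℕ → RatFunc F) (x : RatFunc.CompletionAtInfty F) : Prop :=
  Tendsto (fun d => algebraMap (RatFunc F) (RatFunc.CompletionAtInfty F) (f d)) atTop (𝓝 x)

theorem ConvergesTo.zero : ConvergesTo (F := F) 0 0 := by
  simp [ConvergesTo]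

theorem ConvergesTo.add {f g : ℕ → RatFunc F} {x y : RatFunc.CompletionAtInfty F}
    (hf : ConvergesTo f x) (hg : ConvergesTo g y) : ConvergesTo (f + g) (x + y) := by
  simpa [ConvergesTo] using Tendsto.add hf hg

theorem ConvergesTo.smul {f : ℕ → RatFunc F} {x : RatFunc.CompletionAtInfty F}
    (c : RatFunc F) (hf : ConvergesTo f x) : ConvergesTo (c • f) (c • x) := by
  simpa [ConvergesTo, Algebra.smul_def] using Tendsto.const_mul (algebraMap _ _ c) hf

theorem ConvergesTo.unique {f : ℕ → RatFunc F} {x y : RatFunc.CompletionAtInfty F}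
    (hx : ConvergesTo f x) (hy : ConvergesTo f y) : x = y := tendsto_nhds_unique hx hy

/-- If the members of `S` converge to elements of a subspace, so do their linear combinations. -/
theorem ConvergesTo.exists_mem_span {S : Set (ℕ → RatFunc F)}
    {M : Submodule (RatFunc F) (RatFunc.CompletionAtInfty F)}
    (hS : ∀ f ∈ S, ∃ x ∈ M, ConvergesTo f x) {f : ℕ → RatFunc F}
    (hf : f ∈ Submodule.span (RatFunc F) S) : ∃ x ∈ M, ConvergesTo f x := by
  induction hf using Submodule.span_induction with
  | mem f hf => exact hS f hf
  | zero => exact ⟨0, zero_mem _, .zero⟩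
  | add f g _ _ hf hg =>
    obtain ⟨x, hx, hfx⟩ := hf
    obtain ⟨y, hy, hgy⟩ := hg
    exact ⟨x + y, add_mem hx hy, hfx.add hgy⟩
  | smul c f _ hf =>
    obtain ⟨x, hx, hfx⟩ := hf
    exact ⟨c • x, Submodule.smul_mem _ c hx, hfx.smul c⟩

theorem zetaTerm_eq (a : PositiveArray F) : zetaTerm a = fun P : MonicTuple F a.depth =>
    algebraMap (RatFunc F) (RatFunc.CompletionAtInfty F)
      (∏ i, RatFunc.C (a.ε i : F) ^ (P.1 i).natDegree *
        (algebraMap (Polynomial F) (RatFunc F) (P.1 i))⁻¹ ^ a.s i) := by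
  ext P
  simp [zetaTerm, div_eq_mul_inv]

variable {ι : Type*} {fib : ℕ → Finset ι} {deg : ι → ℕ} {r : ℕ}
  {p : (Fin r → ι) → Prop}

theorem summable_tuples (hfib : ∀ d, ∀ x ∈ fib d, deg x = d)
    (hp : ∀ x, p x ↔ (∀ i, x i ∈ fib (deg (x i))) ∧ StrictAnti fun i => deg (x i))
    (ψ : Fin r → ι → RatFunc F)
    (hψ : ∀ i x, x ∈ fib (deg x) → RatFunc.inftyValuation F (ψ i x) ≤ exp (-(deg x : ℤ))) :
    Summable fun x : {x // p x} =>
      algebraMap (RatFunc F) (RatFunc.CompletionAtInfty F) (∏ i, ψ i (x.1 i)) := by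
  classical
  refine summable_of_valuation_le (fun D => (tuplesBelow fib r D).subtype p) fun D x hx => ?_
  rw [mem_subtype, mem_tuplesBelow hfib] at hx
  obtain ⟨h1, h2⟩ := (hp x.1).mp x.2
  have h3 : ¬ ∀ i, deg (x.1 i) < D := fun h3 => hx ⟨h1, h2, h3⟩
  push Not at h3
  obtain ⟨i, hi⟩ := h3
  rw [valued_algebraMap, map_prod, ← mul_prod_erase _ _ (mem_univ i)]
  have h4 : ∏ j ∈ univ.erase i, RatFunc.inftyValuation F (ψ j (x.1 j)) ≤ 1 :=
    prod_le_one' fun j _ => (hψ j _ (h1 j)).trans (exp_neg_natCast_le_one _)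
  calc _ ≤ exp (-(deg (x.1 i) : ℤ)) * 1 := mul_le_mul' (hψ i _ (h1 i)) h4
    _ ≤ _ := by rw [mul_one]; exact exp_le_exp.mpr (by omega)

theorem tendsto_sum_tuplesBelow (hfib : ∀ d, ∀ x ∈ fib d, deg x = d)
    (hp : ∀ x, p x ↔ (∀ i, x i ∈ fib (deg (x i))) ∧ StrictAnti fun i => deg (x i))
    {g : (Fin r → ι) → RatFunc F} (hg : Summable fun x : {x // p x} =>
      algebraMap (RatFunc F) (RatFunc.CompletionAtInfty F) (g x.1)) :
    Tendsto (fun D => algebraMap (RatFunc F) (RatFunc.CompletionAtInfty F)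
      (∑ x ∈ tuplesBelow fib r D, g x)) atTop
      (𝓝 (∑' x : {x // p x}, algebraMap (RatFunc F) (RatFunc.CompletionAtInfty F) (g x.1))) := by
  classical
  have hmono : Monotone fun D => (tuplesBelow fib r D).subtype p := by
    intro D E hDE x hx
    rw [mem_subtype, mem_tuplesBelow hfib] at hx ⊢
    exact ⟨hx.1, hx.2.1, fun i => (hx.2.2 i).trans_le hDE⟩
  have hex (x : {x // p x}) : ∃ D, x ∈ (tuplesBelow fib r D).subtype p := by
    obtain ⟨h1, h2⟩ := (hp x.1).mp x.2
    refine ⟨univ.sup (fun i => deg (x.1 i)) + 1, ?_⟩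
    rw [mem_subtype, mem_tuplesBelow hfib]
    exact ⟨h1, h2, fun i => Nat.lt_succ_of_le (le_sup (f := fun i => deg (x.1 i)) (mem_univ i))⟩
  refine (hg.hasSum.comp (tendsto_atTop_finset_of_monotone hmono hex)).congr fun D => ?_
  rw [Function.comp_apply, sum_subtype_of_mem (fun x =>
    algebraMap (RatFunc F) (RatFunc.CompletionAtInfty F) (g x)), map_sum]
  intro x hx
  rw [mem_tuplesBelow hfib] at hx
  exact (hp x).mpr ⟨hx.1, hx.2.1⟩

end Valuation

/-! ### Arrays as words -/

section Arrays

variable {F : Type*} [Field F]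

/-- The word `(ε_1, s_1) ⋯ (ε_r, s_r)` of an array. -/
def PositiveArray.word (a : PositiveArray F) : List (Fˣ × ℕ) := List.ofFn fun i => (a.ε i, a.s i)

theorem PositiveArray.isWord_word (a : PositiveArray F) : IsWord a.weight a.word where
  pos := by
    simp only [word, List.mem_ofFn]
    rintro _ ⟨i, rfl⟩
    exact a.s_pos i
  weight_eq := by
    simp [word, List.map_ofFn, List.sum_ofFn, weight]

theorem exists_word_eq {w : ℕ} {W : List (Fˣ × ℕ)} (hW : IsWord w W) :
    ∃ a : PositiveArray F, a.weight = w ∧ a.word = W := by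
  let a : PositiveArray F := ⟨W.length, fun i => (W.get i).1, fun i => (W.get i).2,
    fun i => hW.pos _ (List.get_mem W i)⟩
  have h : a.word = W := List.ofFn_get W
  refine ⟨a, ?_, h⟩
  have h1 := a.isWord_word.weight_eq
  rw [h] at h1
  exact h1.symm.trans hW.weight_eq

variable [Fintype F]

theorem PositiveArray.isAT_of_isGood {a : PositiveArray F} (h : IsGood a.word) : a.IsAT := by
  intro i
  have hi : i.val < a.word.length := by simp [word]
  have h1 : a.word = a.word.take i ++ (a.ε i, a.s i) :: a.word.drop (i + 1) := by
    have h2 : (a.ε i, a.s i) = a.word[i.val] := by simp [word]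
    rw [h2, List.getElem_cons_drop, List.take_append_drop]
  obtain ⟨h2, h3⟩ := h _ _ _ h1
  exact ⟨h2, fun h4 => h3 (List.drop_eq_nil_of_le (by simp [word, h4]))⟩

/-- The function `d ↦ ε^d S_d(s)` attached to the letter `(ε, s)`. -/
def zetaLetter (a : Fˣ × ℕ) (d : ℕ) : RatFunc F :=
  RatFunc.C (a.1 : F) ^ d * powerSum F a.2 d

theorem zetaLetter_mem_liTopSpan {a : Fˣ × ℕ} (ha : 0 < a.2) :
    zetaLetter a ∈ liTopSpan F a.2 := by
  have h (f : ℕ → RatFunc F) (hf : f ∈ liTopSpan F a.2) :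
      (fun d => RatFunc.C (a.1 : F) ^ d) * f ∈ liTopSpan F a.2 := by
    induction hf using Submodule.span_induction with
    | mem f hf =>
      obtain ⟨b, W, hW, rfl⟩ := hf
      obtain ⟨hb, m, hW', hm⟩ := isWord_cons.mp hW
      refine Submodule.subset_span ⟨(a.1 * b.1, b.2), W, isWord_cons.mpr ⟨hb, m, hW', hm⟩, ?_⟩
      ext d
      simp only [liLetter, Pi.mul_apply, Units.val_mul, map_mul, mul_pow]
      ring
    | zero => rw [mul_zero]; exact zero_mem _
    | add f g _ _ hf hg => rw [mul_add]; exact add_mem hf hg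
    | smul c f _ hf => rw [mul_smul_comm]; exact Submodule.smul_mem _ c hf
  exact h _ (powerSum_mem_liTopSpan F ha)

theorem nestedSum_zetaLetter_mem_liSpan {w : ℕ} {W : List (Fˣ × ℕ)} (hW : IsWord w W) :
    nestedSum zetaLetter W ∈ liSpan F w := by
  induction W generalizing w with
  | nil => exact nestedSum_mem_liSpan hW
  | cons a W ih =>
    obtain ⟨ha, m, hW', rfl⟩ := isWord_cons.mp hW
    have h := weightedSum_one_mem_liSpan (mul_mem_liTopSpan (zetaLetter_mem_liTopSpan ha) (ih hW'))
    convert h using 1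
    ext d
    simp [nestedSum_cons, weightedSum_apply]

end Arrays

/-! ### Zeta values and polylogarithms as limits of nested sums -/

section Limits

open Filter Topology WithZero

variable {F : Type*} [Field F] [Fintype F] [DecidableEq (RatFunc F)]

local notation "q" => Fintype.card F

theorem inftyValuation_inv_ell_le (d : ℕ) :
    RatFunc.inftyValuation F (ell F d)⁻¹ ≤ exp (-(d : ℤ)) := by
  induction d with
  | zero => simp [ell_zero]
  | succ d ih =>
    have h1 : RatFunc.inftyValuation F (RatFunc.X ^ q ^ (d + 1)) = exp ((q ^ (d + 1) : ℕ) : ℤ) := by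
      rw [map_pow, RatFunc.inftyValuation.X, ← exp_nsmul]
      simp
    have hq : 1 < q ^ (d + 1) := Nat.one_lt_pow (by omega) Fintype.one_lt_card
    have h2 : RatFunc.inftyValuation F (RatFunc.X - RatFunc.X ^ q ^ (d + 1)) =
        exp ((q ^ (d + 1) : ℕ) : ℤ) := by
      rw [Valuation.map_sub_eq_of_lt_right, h1]
      rw [h1, RatFunc.inftyValuation.X]
      exact exp_lt_exp.mpr (by exact_mod_cast hq)
    rw [ell_succ, mul_inv, map_mul, map_inv₀ _ (RatFunc.X - _), h2, ← exp_neg]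
    calc _ ≤ exp (-(d : ℤ)) * exp (-1) := mul_le_mul' ih (exp_le_exp.mpr (by omega))
      _ = _ := by rw [← exp_add]; congr 1; push_cast; ring

theorem inftyValuation_liLetter_le {a : Fˣ × ℕ} (ha : 0 < a.2) (d : ℕ) :
    RatFunc.inftyValuation F (liLetter a d) ≤ exp (-(d : ℤ)) := by
  have h := inftyValuation_inv_ell_le (F := F) d
  rw [liLetter, map_mul, inftyValuation_C_unit_pow, one_mul, map_pow]
  exact (pow_le_of_le_one zero_le (h.trans (exp_neg_natCast_le_one d)) ha.ne').trans h

theorem inftyValuation_nestedSum_le {W : List (Fˣ × ℕ)} (hW : ∀ a ∈ W, 0 < a.2) (d : ℕ) :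
    RatFunc.inftyValuation F (nestedSum liLetter W d) ≤ 1 := by
  induction W generalizing d with
  | nil => simp
  | cons a W ih =>
    rw [nestedSum_cons, weightedSum_apply]
    refine Valuation.map_sum_le _ fun j _ => ?_
    rw [map_mul]
    exact mul_le_one' ((inftyValuation_liLetter_le (hW a (by simp)) j).trans
      (exp_neg_natCast_le_one j)) (ih (fun b hb => hW b (by simp [hb])) j)

theorem convergesTo_zero_of_mem_liTopSpan {w : ℕ} {f : ℕ → RatFunc F}
    (hf : f ∈ liTopSpan F w) : ConvergesTo f 0 := by
  obtain ⟨x, hx, h⟩ := ConvergesTo.exists_mem_span (M := ⊥) (by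
    rintro _ ⟨a, W, hW, rfl⟩
    refine ⟨0, zero_mem _, tendsto_zero_of_valuation_le fun d => ?_⟩
    rw [valued_algebraMap, Pi.mul_apply, map_mul, ← mul_one (exp (-(d : ℤ)))]
    exact mul_le_mul' (inftyValuation_liLetter_le (hW.pos a (by simp)) d)
      (inftyValuation_nestedSum_le (fun b hb => hW.pos b (by simp [hb])) d)) hf
  rwa [(Submodule.mem_bot _).mp hx] at h

theorem liTerm_eq (a : PositiveArray F) : liTerm a = fun d : DegreeTuple a.depth =>
    algebraMap (RatFunc F) (RatFunc.CompletionAtInfty F)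
      (∏ i, liLetter (a.ε i, a.s i) (d.1 i)) := by
  ext d
  simp [liTerm, liLetter, div_eq_mul_inv]

theorem summable_liTerm (a : PositiveArray F) : Summable (liTerm a) := by
  rw [liTerm_eq]
  exact summable_tuples (fib := fun d => {d}) (deg := id) (by simp) (by simp)
    (fun i => liLetter (a.ε i, a.s i)) fun i d _ => inftyValuation_liLetter_le (a.s_pos i) d

theorem convergesTo_Li (a : PositiveArray F) :
    ConvergesTo (nestedSum liLetter a.word) (Li a) := by
  have h := summable_liTerm a
  rw [liTerm_eq] at h
  rw [Li, liTerm_eq]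
  have h1 := tendsto_sum_tuplesBelow (fib := fun d => {d}) (deg := id) (by simp) (by simp)
    (g := fun d => ∏ i, liLetter (a.ε i, a.s i) (d i)) h
  refine h1.congr fun D => ?_
  rw [sum_tuplesBelow (deg := id) (by simp) liLetter (fun i => (a.ε i, a.s i))]
  simp only [sum_singleton]
  rfl

theorem summable_zetaTerm (a : PositiveArray F) : Summable (zetaTerm a) := by
  rw [zetaTerm_eq]
  refine summable_tuples (fib := monics F) (deg := Polynomial.natDegree)
    (fun d P hP => (mem_monics.mp hP).2) (by simp [mem_monics])
    (fun i P => RatFunc.C (a.ε i : F) ^ P.natDegree *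
      (algebraMap (Polynomial F) (RatFunc F) P)⁻¹ ^ a.s i) fun i P hP => ?_
  have h : RatFunc.inftyValuation F (algebraMap (Polynomial F) (RatFunc F) P)⁻¹ =
      exp (-(P.natDegree : ℤ)) := by
    rw [map_inv₀, RatFunc.inftyValuation_apply,
      RatFunc.inftyValuation.polynomial _ (mem_monics.mp hP).1.ne_zero, exp_neg]
  rw [map_mul, inftyValuation_C_unit_pow, one_mul, map_pow, h]
  exact pow_le_of_le_one zero_le (exp_neg_natCast_le_one _) (a.s_pos i).ne'

theorem convergesTo_zeta (a : PositiveArray F) :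
    ConvergesTo (nestedSum zetaLetter a.word) (zeta a) := by
  have h := summable_zetaTerm a
  rw [zetaTerm_eq] at h
  rw [zeta, zetaTerm_eq]
  have h1 := tendsto_sum_tuplesBelow (fib := monics F) (deg := Polynomial.natDegree)
    (fun d P hP => (mem_monics.mp hP).2) (by simp [mem_monics])
    (g := fun P => ∏ i, RatFunc.C (a.ε i : F) ^ (P i).natDegree *
      (algebraMap (Polynomial F) (RatFunc F) (P i))⁻¹ ^ a.s i) h
  refine h1.congr fun D => ?_
  rw [sum_tuplesBelow (deg := Polynomial.natDegree) (fun d P hP => (mem_monics.mp hP).2)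
    (fun (b : Fˣ × ℕ) P => RatFunc.C (b.1 : F) ^ P.natDegree *
      (algebraMap (Polynomial F) (RatFunc F) P)⁻¹ ^ b.2) (fun i => (a.ε i, a.s i))]
  have h2 : (fun (b : Fˣ × ℕ) d => ∑ P ∈ monics F d, RatFunc.C (b.1 : F) ^ P.natDegree *
      (algebraMap (Polynomial F) (RatFunc F) P)⁻¹ ^ b.2) = zetaLetter := by
    ext b d
    rw [zetaLetter, powerSum, mul_sum]
    exact sum_congr rfl fun P hP => by rw [(mem_monics.mp hP).2]
  rw [h2]
  rfl

theorem zeta_eq_Li {a : PositiveArray F} (ha : a.IsAT) : zeta a = Li a := by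
  have h (W : List (Fˣ × ℕ)) (hW : ∀ b ∈ W, zetaLetter b = liLetter b) :
      nestedSum zetaLetter W = nestedSum liLetter W := by
    induction W with
    | nil => rfl
    | cons b W ih =>
      rw [nestedSum_cons, nestedSum_cons, hW b (by simp), ih fun c hc => hW c (by simp [hc])]
  refine (convergesTo_zeta a).unique ?_
  rw [h]
  · exact convergesTo_Li a
  · simp only [PositiveArray.word, List.mem_ofFn]
    rintro _ ⟨i, rfl⟩
    ext d
    rw [zetaLetter, powerSum_eq_inv_ell_pow F (a.s_pos i) (ha i).1, liLetter]

theorem AZ_le_AL (w : ℕ) : AZ F w ≤ AL F w := by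
  refine Submodule.span_le.mpr ?_
  rintro _ ⟨a, rfl, rfl⟩
  obtain ⟨x, hx, h⟩ := ConvergesTo.exists_mem_span (M := AL F a.weight) (by
    rintro _ ⟨W, hW, rfl⟩
    obtain ⟨b, hb, rfl⟩ := exists_word_eq hW
    exact ⟨Li b, Submodule.subset_span ⟨b, hb, rfl⟩, convergesTo_Li b⟩)
    (nestedSum_zetaLetter_mem_liSpan a.isWord_word)
  rwa [(convergesTo_zeta a).unique h]

theorem AL_le_span_AT (w : ℕ) : AL F w ≤ Submodule.span (RatFunc F) (AT F w) := by
  refine Submodule.span_le.mpr ?_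
  rintro _ ⟨a, rfl, rfl⟩
  obtain ⟨f, hf, g, hg, hfg⟩ := Submodule.mem_sup.mp (nestedSum_mem_goodSpan_sup a.isWord_word)
  obtain ⟨x, hx, h⟩ := ConvergesTo.exists_mem_span
    (M := Submodule.span (RatFunc F) (AT F a.weight)) (by
    rintro _ ⟨W, hW, hgood, rfl⟩
    obtain ⟨b, hb, rfl⟩ := exists_word_eq hW
    exact ⟨Li b, Submodule.subset_span ⟨b, hb, PositiveArray.isAT_of_isGood hgood, rfl⟩,
      convergesTo_Li b⟩) hf
  have h1 := h.add (convergesTo_zero_of_mem_liTopSpan hg)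
  rw [hfg, add_zero] at h1
  rwa [(convergesTo_Li a).unique h1]

theorem span_AT_le_AZ (w : ℕ) : Submodule.span (RatFunc F) (AT F w) ≤ AZ F w := by
  refine Submodule.span_mono ?_
  rintro _ ⟨a, hw, ha, rfl⟩
  exact ⟨a, hw, zeta_eq_Li ha⟩

end Limits
end CharPMZV
end

theorem mainTheorem7 (F : Type*) [Field F] [Fintype F] [DecidableEq (RatFunc F)] (w : ℕ) :
    (∀ a : CharPMZV.PositiveArray F, a.weight = w →
      Summable (CharPMZV.zetaTerm a) ∧ Summable (CharPMZV.liTerm a)) ∧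
    CharPMZV.AZ F w = CharPMZV.AL F w ∧
    (∀ a : CharPMZV.PositiveArray F, a.weight = w → a.IsAT →
      CharPMZV.zeta a = CharPMZV.Li a) ∧
    Submodule.span (RatFunc F) (CharPMZV.AT F w) = CharPMZV.AL F w ∧
    Submodule.span (RatFunc F) (CharPMZV.AT F w) = CharPMZV.AZ F w := by
  have h1 := CharPMZV.AZ_le_AL (F := F) w
  have h2 := CharPMZV.AL_le_span_AT (F := F) w
  have h3 := CharPMZV.span_AT_le_AZ (F := F) w
  exact ⟨fun a _ => ⟨CharPMZV.summable_zetaTerm a, CharPMZV.summable_liTerm a⟩,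
    le_antisymm h1 (h2.trans h3), fun a _ ha => CharPMZV.zeta_eq_Li ha,
    le_antisymm (h3.trans h1) h2, le_antisymm h3 (h1.trans h2)⟩
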